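/- **Setting.** Let $K\subset S^3$ be a hyperbolic knot, i.e. a smoothly embedded circle whose complement carries a complete hyperbolic structure of finite volume, and let $\psi$ be a diffeomorphism of $S^3$ of odd prime order $p$ with $\psi(K)=K$. (Since $p$ is odd, $\psi$ automatically preserves the orientation of $S^3$.) Let $E(K)$ be the exterior of $K$, the complement of a $\psi$-invariant open tubular neighbourhood of $K$. Let $\pi=\pi_1(E(K))$ and let $\Gamma=\pi_1(E(K)/\psi)$ be the orbifold fundamental group of the quotient of $E(K)$ by the cyclic group generated by $\psi$ (the ordinary fundamental group if $\psi$ acts freely), so that $\pi$ is a normal subgroup of $\Gamma$ with quotient $\mathbb Z/p\mathbb Z$. **Character varieties.** For a group $G$ let $\mathbf X(G)$ be the set of characters $\chi_\rho=\operatorname{tr}\rho$ of representations $\rho:G\to \mathrm{SL}_2(\mathbb C)$, with the Zariski topology given by the coordinate functions $\chi\mapsto\chi(\gamma)$, $\gamma\in G$. A representation is irreducible if no line in $\mathbb C^2$ is $\rho(G)$-invariant, and a character is irreducible if it is the character of an irreducible representation. Let $\mathbf X_{\mathrm{ab}}(G)$ be the set of characters of abelian representations, and let $X(G)$ be the union of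 the irreducible components of $\mathbf X(G)$ not contained in $\mathbf X_{\mathrm{ab}}(G)$. Write $X(K)=X(\pi)$ and $X(E(K)/\psi)=X(\Gamma)$. The symmetry $\psi$ induces an outer automorphism $\psi_*$ of $\pi$, hence acts on $X(K)$. The invariant subvariety $X(K)^\psi$ is the union of those irreducible components of the fixed-point set of this action on $X(K)$ that are not contained in $\mathbf X_{\mathrm{ab}}(\pi)$. **Proposition.** The sets of irreducible characters of $\Gamma$ and of $\pi$ are Zariski open in $\mathbf X(\Gamma)$ and $\mathbf X(\pi)$ respectively. Restriction of characters from $\Gamma$ to $\pi$ maps $X(E(K)/\psi)$ into $X(K)^\psi$, and it induces a bijection from the set of irreducible characters in $X(E(K)/\psi)$ onto the set of irreducible characters in $X(K)^\psi$. Moreover, every irreducible representation $\rho:\pi\to\mathrm{SL}_2(\mathbb C)$ whose character lies in $X(K)^\psi$ extends in a unique way to a representation $\Gamma\to\mathrm{SL}_2(\mathbb C)$. -/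

import Mathlib

open scoped Manifold ContDiff
open MeasureTheory

/-! ### Representations into `SL₂(ℂ)` and character varieties -/

section CharacterVarieties

/-- The group `SL₂(ℂ)`. -/
abbrev SL2C : Type := Matrix.SpecialLinearGroup (Fin 2) ℂ

/-- The character `γ ↦ trace (ρ γ)` of a representation `ρ : G → SL₂(ℂ)`. -/
noncomputable def character {G : Type*} [Group G] (ρ : G →* SL2C) (γ : G) : ℂ :=
  Matrix.trace (ρ γ : Matrix (Fin 2) (Fin 2) ℂ)

/-- `ρ` is reducible if some one-dimensional subspace of `ℂ²` is `ρ(G)`-invariant. -/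
def IsReducibleRep {G : Type*} [Group G] (ρ : G →* SL2C) : Prop :=
  ∃ W : Submodule ℂ (Fin 2 → ℂ), Module.finrank ℂ W = 1 ∧
    ∀ γ : G, ∀ v ∈ W, Matrix.mulVec (ρ γ : Matrix (Fin 2) (Fin 2) ℂ) v ∈ W

/-- `ρ` is irreducible if it is not reducible. -/
def IsIrreducibleRep {G : Type*} [Group G] (ρ : G →* SL2C) : Prop :=
  ¬ IsReducibleRep ρ

/-- The set `𝐗(G)` of all characters of representations `G → SL₂(ℂ)`. -/
@[ext]
structure CharacterVariety (G : Type*) [Group G] where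
  toFun : G → ℂ
  exists_rep : ∃ ρ : G →* SL2C, character ρ = toFun

namespace CharacterVariety

variable {G H : Type*} [Group G] [Group H]

/-- The point of `𝐗(G)` given by a representation. -/
noncomputable def ofRep (ρ : G →* SL2C) : CharacterVariety G :=
  ⟨character ρ, ρ, rfl⟩

/-- The Zariski topology on `𝐗(G)`, the coordinate functions being the evaluations
`τ_γ : χ ↦ χ(γ)`, `γ ∈ G`: the sets `{χ | f(χ) ≠ 0}`, for `f` a polynomial in the `τ_γ`,
form a basis, so that the closed sets are the common zero loci of such polynomials. -/
instance zariskiTopology : TopologicalSpace (CharacterVariety G) :=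
  TopologicalSpace.generateFrom
    {U | ∃ f : MvPolynomial G ℂ, U = {χ | MvPolynomial.eval χ.toFun f ≠ 0}}

/-- Pull-back of characters `χ ↦ χ ∘ f` along a homomorphism `f : H → G`.  For the inclusion of
a subgroup this is restriction; for an automorphism, the action on `𝐗(G)`. -/
def pullback (f : H →* G) (χ : CharacterVariety G) : CharacterVariety H where
  toFun := fun γ => χ.toFun (f γ)
  exists_rep := by
    obtain ⟨ρ, hρ⟩ := χ.exists_rep
    exact ⟨ρ.comp f, by funext γ; rw [← hρ]; rfl⟩

/-- The irreducible characters: those of irreducible representations. -/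
def irreducibleCharacters (G : Type*) [Group G] : Set (CharacterVariety G) :=
  {χ | ∃ ρ : G →* SL2C, IsIrreducibleRep ρ ∧ χ = ofRep ρ}

/-- `𝐗_ab(G)`, the characters of abelian representations. -/
def abelianCharacters (G : Type*) [Group G] : Set (CharacterVariety G) :=
  {χ | ∃ ρ : G →* SL2C, (∀ a b : G, Commute (ρ a) (ρ b)) ∧ χ = ofRep ρ}

/-- The irreducible components of a subset `A ⊆ 𝐗(G)` in the Zariski topology: the maximal
irreducible subsets of `A`. -/
def components (A : Set (CharacterVariety G)) : Set (Set (CharacterVariety G)) :=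
  {Z | Maximal (fun T : Set (CharacterVariety G) => T ⊆ A ∧ IsIrreducible T) Z}

/-- The union of the irreducible components of `A` that are not contained in `𝐗_ab(G)`. -/
def nonabelianPart (A : Set (CharacterVariety G)) : Set (CharacterVariety G) :=
  ⋃₀ {Z | Z ∈ components A ∧ ¬ Z ⊆ abelianCharacters G}

/-- `X(G)`, the union of the irreducible components of `𝐗(G)` not contained in `𝐗_ab(G)`. -/
def mainPart (G : Type*) [Group G] : Set (CharacterVariety G) :=
  nonabelianPart Set.univ

end CharacterVariety

end CharacterVarieties

/-! ### The (orbifold) fundamental group of a quotient -/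

section OrbifoldGroup

variable {X : Type*} [TopologicalSpace X]

/-- The orbifold fundamental group of the quotient `X/Γ`, for a group `Γ` of homeomorphisms of `X`:
its elements are the pairs `(g, [α])` with `g ∈ Γ` and `[α]` a homotopy class (relative to the
endpoints) of paths from `g x₀` to `x₀`, with `(g, [α]) (h, [β]) = (g h, [g(β) followed by α])`.
Equivalently, it is the group of all lifts of elements of `Γ` to the universal cover of `X`, and it
is an extension of `Γ` by `π₁(X, x₀)` when `X` is path connected.  (For a free action it is the
fundamental group of `X/Γ`.)  The orientation of paths matches the multiplication
of `FundamentalGroup`, in which `p * q` is `q` followed by `p`. -/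
@[ext]
structure OrbifoldGroup (Γ : Subgroup (X ≃ₜ X)) (x₀ : X) where
  elt : Γ
  path : Path.Homotopic.Quotient ((elt : X ≃ₜ X) x₀) x₀

namespace OrbifoldGroup

variable {Γ : Subgroup (X ≃ₜ X)} {x₀ : X}

/-- A homeomorphism as a bundled continuous map. -/
abbrev toMap (g : X ≃ₜ X) : C(X, X) := ⟨g, g.continuous⟩

theorem ext_cast {a b : OrbifoldGroup Γ x₀} (h : a.elt = b.elt)
    (hp : a.path = b.path.cast (by rw [h]) rfl) : a = b := by
  obtain ⟨g, α⟩ := a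
  obtain ⟨g', β⟩ := b
  obtain rfl : g = g' := h
  simp only [Path.Homotopic.Quotient.cast_rfl_rfl] at hp
  rw [hp]

noncomputable instance : Mul (OrbifoldGroup Γ x₀) where
  mul a b := ⟨a.elt * b.elt, (b.path.map (toMap (a.elt : X ≃ₜ X))).trans a.path⟩

instance : One (OrbifoldGroup Γ x₀) where
  one := ⟨1, Path.Homotopic.Quotient.refl x₀⟩

instance : Inv (OrbifoldGroup Γ x₀) where
  inv a := ⟨a.elt⁻¹, (a.path.symm.map (toMap ((a.elt : X ≃ₜ X)⁻¹))).cast rfl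
    ((a.elt : X ≃ₜ X).symm_apply_apply x₀).symm⟩

theorem map_trans' {x y z : X} (f : C(X, X)) (p : Path.Homotopic.Quotient x y)
    (q : Path.Homotopic.Quotient y z) : (p.trans q).map f = (p.map f).trans (q.map f) := by
  induction p with | mk p =>
  induction q with | mk q =>
  exact congrArg Path.Homotopic.Quotient.mk (Path.map_trans p q f.continuous)

theorem map_symm' {x y : X} (f : C(X, X)) (p : Path.Homotopic.Quotient x y) :
    p.symm.map f = (p.map f).symm := by
  induction p with | mk p =>
  exact congrArg Path.Homotopic.Quotient.mk (Path.map_symm p f.continuous)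

noncomputable instance : Group (OrbifoldGroup Γ x₀) :=
  Group.ofLeftAxioms
    (by
      intro a b c
      refine ext_cast (mul_assoc a.elt b.elt c.elt) ?_
      have key : ∀ {g h k : X ≃ₜ X} (α : Path.Homotopic.Quotient (g x₀) x₀)
          (β : Path.Homotopic.Quotient (h x₀) x₀) (γ : Path.Homotopic.Quotient (k x₀) x₀),
          (γ.map (toMap (g * h))).trans ((β.map (toMap g)).trans α) =
            (((γ.map (toMap h)).trans β).map (toMap g)).trans α := by
        intro g h k α β γ
        rw [map_trans', Path.Homotopic.Quotient.trans_assoc]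
        induction γ with | mk γ =>
        rfl
      have := key a.path b.path c.path
      exact this.trans (Path.Homotopic.Quotient.cast_rfl_rfl _).symm)
    (by
      intro a
      refine ext_cast (one_mul a.elt) ?_
      have key : ∀ {g : X ≃ₜ X} (α : Path.Homotopic.Quotient (g x₀) x₀),
          (α.map (toMap (1 : X ≃ₜ X))).trans (Path.Homotopic.Quotient.refl x₀) = α := by
        intro g α
        induction α with | mk α =>
        exact Path.Homotopic.Quotient.trans_refl _
      exact (key a.path).trans (Path.Homotopic.Quotient.cast_rfl_rfl _).symm)
    (by
      intro a
      refine ext_cast (inv_mul_cancel a.elt) ?_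
      have key : ∀ {x y z : X} (p : Path.Homotopic.Quotient x y) (hz : z = x),
          p.trans (p.symm.cast rfl hz) = (Path.Homotopic.Quotient.refl z).cast hz.symm rfl := by
        intro x y z p hz
        subst hz
        simp
      have h := key (a.path.map (toMap ((a.elt : X ≃ₜ X)⁻¹)))
        ((a.elt : X ≃ₜ X).symm_apply_apply x₀).symm
      rw [← map_symm'] at h
      exact h)

/-- The inclusion `π₁(X, x₀) → π₁ᵒʳᵇ(X/Γ)` of the normal subgroup of pairs `(1, [α])`. -/
noncomputable def inclusion (Γ : Subgroup (X ≃ₜ X)) (x₀ : X) :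
    FundamentalGroup X x₀ →* OrbifoldGroup Γ x₀ where
  toFun α := ⟨1, α⟩
  map_one' := rfl
  map_mul' α β := by
    have key : ∀ α β : Path.Homotopic.Quotient x₀ x₀,
        β.trans α = (β.map (toMap (1 : X ≃ₜ X))).trans α := by
      intro α β
      induction β with | mk β =>
      rfl
    refine ext_cast (one_mul 1).symm ?_
    exact (key α β).trans (Path.Homotopic.Quotient.cast_rfl_rfl _).symm

end OrbifoldGroup

/-- For a homeomorphism `φ` of `X` and a path `γ` from `φ x₀` to `x₀`, the endomorphism
`[α] ↦ [γ⁻¹ · φ(α) · γ]` of `π₁(X, x₀)`.  When `φ` belongs to `Γ` it is the conjugation by the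
element `(φ, [γ])` of the orbifold fundamental group of `X/Γ`, and when `X` is path connected these
maps, for varying `γ`, are the representatives of the outer automorphism `φ_*`. -/
noncomputable def inducedAut (φ : X ≃ₜ X) {x₀ : X} (γ : Path (φ x₀) x₀) :
    FundamentalGroup X x₀ →* FundamentalGroup X x₀ :=
  (FundamentalGroup.fundamentalGroupMulEquivOfPath γ).toMonoidHom.comp
    (FundamentalGroup.map (⟨φ, φ.continuous⟩ : C(X, X)) x₀)

/-- The invariant subvariety `X(π₁ X)^φ`: in the set of points of `X(π₁(X, x₀))` that are fixed by
the action of `φ_*`, the union of the irreducible components not contained in `𝐗_ab`. -/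
def invariantSubvariety (φ : X ≃ₜ X) (x₀ : X) :
    Set (CharacterVariety (FundamentalGroup X x₀)) :=
  CharacterVariety.nonabelianPart
    {χ | χ ∈ CharacterVariety.mainPart (FundamentalGroup X x₀) ∧
      ∀ γ : Path (φ x₀) x₀, χ.pullback (inducedAut φ γ) = χ}

/-- The orbifold fundamental group of the quotient of `X` by the cyclic group generated by `φ`. -/
abbrev QuotientGroupOf (φ : X ≃ₜ X) (x₀ : X) : Type _ :=
  OrbifoldGroup (Subgroup.zpowers φ) x₀

/-- Restriction of characters from the orbifold fundamental group of `X/⟨φ⟩` to `π₁(X, x₀)`. -/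
noncomputable def restriction (φ : X ≃ₜ X) (x₀ : X) :
    CharacterVariety (QuotientGroupOf φ x₀) → CharacterVariety (FundamentalGroup X x₀) :=
  CharacterVariety.pullback (OrbifoldGroup.inclusion (Subgroup.zpowers φ) x₀)

end OrbifoldGroup

/-! ### Knots in the three-sphere, their exteriors, and hyperbolicity -/

section Knots

/-- The sphere `S³`. -/
abbrev S3 : Type := Metric.sphere (0 : EuclideanSpace ℝ (Fin 4)) 1

instance finrankFactS3 : Fact (Module.finrank ℝ (EuclideanSpace ℝ (Fin 4)) = 3 + 1) :=
  ⟨by simp⟩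

/-- A knot: a smoothly embedded circle in `S³`. -/
def IsKnot (K : Set S3) : Prop :=
  ∃ c : Circle → S3, Manifold.IsSmoothEmbedding (𝓡 1) (𝓡 3) ∞ c ∧ Set.range c = K

/-- A parametrised open tubular neighbourhood `S¹ × ℂ → S³` of `K`, with core `K`. -/
structure TubularNeighbourhood (K : Set S3) where
  toFun : Circle × ℂ → S3
  smooth : Manifold.IsSmoothEmbedding ((𝓡 1).prod 𝓘(ℝ, ℂ)) (𝓡 3) ∞ toFun
  isOpen_range : IsOpen (Set.range toFun)
  core : Set.range (fun u : Circle => toFun (u, 0)) = K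

/-- The exterior `E(K)`: the complement of the open tubular neighbourhood of radius `1`. -/
def TubularNeighbourhood.exterior {K : Set S3} (V : TubularNeighbourhood K) : Set S3 :=
  (V.toFun '' {x | ‖x.2‖ < 1})ᶜ

/-- The homeomorphism of `E(K)` given by restricting a diffeomorphism of `S³` that preserves it. -/
noncomputable def restrictToExterior {K : Set S3} (V : TubularNeighbourhood K) (ψ : S3 ≃ₘ⟮𝓡 3, 𝓡 3⟯ S3)
    (hV : ∀ x, x ∈ V.exterior ↔ ψ x ∈ V.exterior) : V.exterior ≃ₜ V.exterior :=
  ψ.toHomeomorph.subtype hV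

/-- Hyperbolic three-space, as the upper half-space `{(z, t) | z ∈ ℂ, t > 0}`. -/
abbrev H3 : Type := {x : ℂ × ℝ // 0 < x.2}

/-- The hyperbolic distance of the upper half-space. -/
noncomputable def hypDist (a b : H3) : ℝ :=
  Real.arcosh (1 + (‖a.1.1 - b.1.1‖ ^ 2 + (a.1.2 - b.1.2) ^ 2) / (2 * a.1.2 * b.1.2))

/-- The hyperbolic volume of a subset of the upper half-space, with density `t⁻³`. -/
noncomputable def hypVolume (D : Set H3) : ENNReal :=
  ∫⁻ x in Subtype.val '' D, ENNReal.ofReal (1 / x.2 ^ 3)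

/-- `K` is hyperbolic if its complement carries a complete hyperbolic structure of finite volume:
there is a covering map `q` from hyperbolic three-space to `S³ ∖ K` whose fibres are permuted
transitively by covering transformations that are hyperbolic isometries, and some measurable set of
finite hyperbolic volume is mapped onto `S³ ∖ K`. -/
def IsHyperbolic (K : Set S3) : Prop :=
  ∃ q : H3 → {x : S3 // x ∉ K}, IsCoveringMap q ∧
    (∀ a b : H3, q a = q b → ∃ g : H3 ≃ₜ H3,
      (∀ x y, hypDist (g x) (g y) = hypDist x y) ∧ (∀ x, q (g x) = q x) ∧ g a = b) ∧
    ∃ D : Set H3, MeasurableSet D ∧ hypVolume D < ⊤ ∧ q '' D = Set.univ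

end Knots

/-!
The exterior of a hyperbolic knot is path connected: the complement of the knot is covered by
hyperbolic space, and it retracts radially onto the exterior.  Hence a path `γ` from `ψ x₀` to `x₀`
exists, and with `m = (ψ, [γ])` the orbifold group `Γ` is an extension of a cyclic group generated
by the image of `m` by `π = π₁(E(K))`.  The order of that cyclic group divides `p`, so it is odd
(`IsOddCyclicExtension`, `isOddCyclicExtension_inclusion`).

*Characters.*  A representation is reducible if and only if its character takes the value `2` on the
whole commutator subgroup (`isReducibleRep_iff_trace_commutator`).  So irreducibility depends only on
the character, the irreducible characters form a Zariski open set, and `𝐗_ab` is its complement,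
because a reducible representation has the character of a diagonal one.  Irreducible representations
with the same character are conjugate (`IsIrreducibleRep.exists_conj_of_character_eq`): by Burnside's
theorem both map the group algebra onto the matrix algebra, with the same kernel, namely the radical
of the trace form, and every automorphism of the matrix algebra is inner.

*Extension.*  Let `ρ` be an irreducible representation of `π` whose character is invariant under
conjugation by `m`.  Then `ρ (m x m⁻¹) = A ρ(x) A⁻¹` for some `A`, which by Schur's lemma is unique
up to sign, and `Aᵈ = ± ρ(mᵈ)` for the order `d` of the quotient.  As `d` is odd, exactly one choice
of the sign of `A` gives `Aᵈ = ρ(mᵈ)`, that is, `ρ` has exactly one extension to `Γ`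
(`IsOddCyclicExtension.existsUnique_extension`).  Conversely, the restriction to `π` of an irreducible
representation of `Γ` is irreducible, again because `d` is odd
(`IsOddCyclicExtension.isIrreducibleRep_comp`).  Restriction is thus a bijection from the irreducible
characters of `Γ` onto the invariant irreducible characters of `π`.

*Components.*  A single irreducible character is an irreducible set, so it lies in some irreducible
component not contained in `𝐗_ab`; therefore no irreducible character is lost in passing to `X(Γ)`,
`X(K)` or `X(K)^ψ`.  A component of `𝐗(Γ)` not contained in `𝐗_ab` contains an irreducible
character; its image under the continuous restriction map is irreducible, is pointwise fixed by `ψ_*`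
and contains an irreducible character, so it lies in `X(K)` and then in `X(K)^ψ`.
-/

/-! ### Two-dimensional representations and their characters -/

section Representations

open Matrix
open scoped commutatorElement

theorem exists_smul_eq_of_mulVec_eq_zero {N : Matrix (Fin 2) (Fin 2) ℂ} (hN : N ≠ 0)
    {y z : Fin 2 → ℂ} (hy : y ≠ 0) (hNy : N *ᵥ y = 0) (hNz : N *ᵥ z = 0) :
    ∃ k : ℂ, z = k • y := by
  have hdet : y 0 * z 1 - y 1 * z 0 = 0 := by
    by_contra hne
    apply hN
    have e : ∀ i, N i 0 * y 0 + N i 1 * y 1 = 0 ∧ N i 0 * z 0 + N i 1 * z 1 = 0 := fun i =>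
      ⟨by simpa [mulVec, dotProduct, Fin.sum_univ_two] using congrFun hNy i,
        by simpa [mulVec, dotProduct, Fin.sum_univ_two] using congrFun hNz i⟩
    have h0 : ∀ i, N i 0 = 0 := fun i => by
      refine (mul_eq_zero.mp ?_).resolve_right hne
      linear_combination z 1 * (e i).1 - y 1 * (e i).2
    have h1 : ∀ i, N i 1 = 0 := fun i => by
      refine (mul_eq_zero.mp ?_).resolve_right hne
      linear_combination -z 0 * (e i).1 + y 0 * (e i).2
    ext i j
    fin_cases j
    · exact h0 i
    · exact h1 i
  by_cases h0 : y 0 = 0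
  · have h1 : y 1 ≠ 0 := fun h1 => hy (by ext i; fin_cases i <;> simp [h0, h1])
    refine ⟨z 1 / y 1, ?_⟩
    have hz : z 0 = 0 := by simpa [h0, h1] using hdet
    ext i
    fin_cases i
    · simp [h0, hz]
    · simp [h1]
  · refine ⟨z 0 / y 0, ?_⟩
    ext i
    fin_cases i
    · simp [h0]
    · simp only [Fin.mk_one, Pi.smul_apply, smul_eq_mul]
      field_simp
      linear_combination hdet

theorem exists_eq_vecMulVec {N : Matrix (Fin 2) (Fin 2) ℂ} (hN : N.det = 0) :
    ∃ u f : Fin 2 → ℂ, N = vecMulVec u f := by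
  by_cases h0 : N = 0
  · exact ⟨0, 0, by rw [h0, zero_vecMulVec]⟩
  obtain ⟨k, l, hkl⟩ : ∃ k l, N k l ≠ 0 := by
    by_contra! h
    exact h0 (Matrix.ext h)
  refine ⟨fun i => N i l, fun j => N k j / N k l, ?_⟩
  ext i j
  have hmin : N i j * N k l = N i l * N k j := by
    rw [det_fin_two] at hN
    fin_cases i <;> fin_cases j <;> fin_cases k <;> fin_cases l <;>
      simp only [Fin.zero_eta, Fin.mk_one] <;>
      first | ring1 | linear_combination hN | linear_combination -hN
  rw [vecMulVec_apply]
  field_simp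
  exact hmin

theorem exists_eigenvector (B : Matrix (Fin 2) (Fin 2) ℂ) :
    ∃ (c : ℂ) (v : Fin 2 → ℂ), v ≠ 0 ∧ B *ᵥ v = c • v := by
  obtain ⟨c, hc⟩ := Module.End.exists_eigenvalue (Matrix.toLin' B)
  obtain ⟨v, hv⟩ := hc.exists_hasEigenvector
  exact ⟨c, v, hv.2, by simpa using hv.apply_eq_smul⟩

namespace DetOne

theorem mul_self_eq {A : Matrix (Fin 2) (Fin 2) ℂ} (h : A.det = 1) : A * A = trace A • A - 1 := by
  rw [det_fin_two] at h
  ext i j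
  fin_cases i <;> fin_cases j <;>
    simp [Matrix.mul_apply, Fin.sum_univ_two, trace_fin_two]
  · linear_combination -h
  · ring
  · ring
  · linear_combination -h

theorem eigenvalue_ne_zero {A : Matrix (Fin 2) (Fin 2) ℂ} (hA : A.det = 1) {v : Fin 2 → ℂ} {c : ℂ}
    (hv : v ≠ 0) (h : A *ᵥ v = c • v) : c ≠ 0 := by
  rintro rfl
  have := Matrix.exists_mulVec_eq_zero_iff.mp ⟨v, hv, by simpa using h⟩
  simp [hA] at this

theorem trace_eq_of_eigenvector {A : Matrix (Fin 2) (Fin 2) ℂ} (hA : A.det = 1) {v : Fin 2 → ℂ}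
    {c : ℂ} (hv : v ≠ 0) (h : A *ᵥ v = c • v) : trace A = c + c⁻¹ := by
  have hc := eigenvalue_ne_zero hA hv h
  have h1 : (A * A) *ᵥ v = (c * c) • v := by
    rw [← mulVec_mulVec, h, mulVec_smul, h, smul_smul]
  rw [mul_self_eq hA, sub_mulVec, smul_mulVec, h, one_mulVec, smul_smul, ← sub_eq_zero] at h1
  have h2 : (trace A * c - 1 - c * c) • v = 0 := by
    rw [← h1]; module
  have h3 := (smul_eq_zero.mp h2).resolve_right hv
  field_simp
  linear_combination h3

end DetOne

/-- A representation into `SL₂(ℂ)`, regarded as a homomorphism to the monoid of all matrices. -/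
def matrixRep {G : Type*} [Group G] (ρ : G →* SL2C) : G →* Matrix (Fin 2) (Fin 2) ℂ :=
  SpecialLinearGroup.coeMonoidHom.comp ρ

section matrixRep

variable {G : Type*} [Group G]

theorem det_matrixRep (ρ : G →* SL2C) (γ : G) : (matrixRep ρ γ).det = 1 := (ρ γ).2

theorem character_apply (ρ : G →* SL2C) (γ : G) : character ρ γ = trace (matrixRep ρ γ) := rfl

theorem eq_of_matrixRep_eq {ρ σ : G →* SL2C} {γ δ : G} (h : matrixRep ρ γ = matrixRep σ δ) :
    ρ γ = σ δ :=
  Subtype.ext h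

theorem exists_matrixRep_eq (R : G →* Matrix (Fin 2) (Fin 2) ℂ) (hR : ∀ γ, (R γ).det = 1) :
    ∃ ρ : G →* SL2C, matrixRep ρ = R :=
  ⟨{ toFun := fun γ => ⟨R γ, hR γ⟩
     map_one' := Subtype.ext (map_one R)
     map_mul' := fun a b => Subtype.ext (map_mul R a b) }, rfl⟩

end matrixRep

/-- Reducibility in terms of a common eigenvector. -/
theorem isReducibleRep_iff_exists_eigenvector {G : Type*} [Group G] {ρ : G →* SL2C} :
    IsReducibleRep ρ ↔ ∃ v : Fin 2 → ℂ, v ≠ 0 ∧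
      ∀ γ : G, ∃ c : ℂ, matrixRep ρ γ *ᵥ v = c • v := by
  constructor
  · rintro ⟨W, hW, h⟩
    obtain ⟨v, hv, hv'⟩ := finrank_eq_one_iff'.mp hW
    refine ⟨v, by simpa using hv, fun γ => ?_⟩
    obtain ⟨c, hc⟩ := hv' ⟨_, h γ v v.2⟩
    exact ⟨c, (congrArg Subtype.val hc).symm⟩
  · rintro ⟨v, hv, h⟩
    refine ⟨ℂ ∙ v, finrank_span_singleton hv, fun γ w hw => ?_⟩
    obtain ⟨k, rfl⟩ := Submodule.mem_span_singleton.mp hw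
    obtain ⟨c, hc⟩ := h γ
    change matrixRep ρ γ *ᵥ (k • v) ∈ _
    rw [mulVec_smul, hc]
    exact Submodule.smul_mem _ _ (Submodule.smul_mem _ _ (Submodule.mem_span_singleton_self v))

namespace IsIrreducibleRep

variable {G : Type*} [Group G] {ρ : G →* SL2C}

theorem eq_top_of_invariant (hρ : IsIrreducibleRep ρ) (W : Submodule ℂ (Fin 2 → ℂ))
    (hW : ∀ γ : G, ∀ v ∈ W, matrixRep ρ γ *ᵥ v ∈ W) (hne : W ≠ ⊥) : W = ⊤ := by
  have h2 : Module.finrank ℂ (Fin 2 → ℂ) = 2 := by simp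
  apply Submodule.eq_top_of_finrank_eq
  have hle := Submodule.finrank_le W
  have h1 : Module.finrank ℂ W ≠ 1 := fun h => hρ ⟨W, h, hW⟩
  have h0 : Module.finrank ℂ W ≠ 0 := fun h => hne (Submodule.finrank_eq_zero.mp h)
  omega

/-- **Schur's lemma.** -/
theorem eq_smul_one_of_commute (hρ : IsIrreducibleRep ρ) {B : Matrix (Fin 2) (Fin 2) ℂ}
    (hB : ∀ γ : G, B * matrixRep ρ γ = matrixRep ρ γ * B) :
    ∃ c : ℂ, B = c • 1 := by
  obtain ⟨c, v, hv, hBv⟩ := exists_eigenvector B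
  refine ⟨c, ?_⟩
  have hmem : ∀ w, w ∈ LinearMap.ker (Matrix.toLin' (B - c • 1)) ↔ B *ᵥ w = c • w := fun w => by
    rw [LinearMap.mem_ker, Matrix.toLin'_apply, sub_mulVec, smul_mulVec, one_mulVec, sub_eq_zero]
  have htop := hρ.eq_top_of_invariant (LinearMap.ker (Matrix.toLin' (B - c • 1)))
    (fun γ w hw => by
      rw [hmem] at hw ⊢
      rw [mulVec_mulVec, hB, ← mulVec_mulVec, hw, mulVec_smul])
    (fun hbot => hv ((Submodule.mem_bot ℂ).mp (hbot ▸ (hmem v).mpr hBv)))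
  rw [LinearMap.ker_eq_top] at htop
  exact sub_eq_zero.mp (Matrix.toLin'.map_eq_zero_iff.mp htop)

theorem eq_one_or_neg_one_of_commute (hρ : IsIrreducibleRep ρ) {B : SL2C}
    (hB : ∀ γ : G, B * ρ γ = ρ γ * B) : B = 1 ∨ B = -1 := by
  obtain ⟨c, hc⟩ := hρ.eq_smul_one_of_commute (B := B.1) fun γ => congrArg Subtype.val (hB γ)
  have hcc : c * c = 1 := by
    have hdet : B.1.det = 1 := B.2
    rw [hc, det_smul, det_one, Fintype.card_fin] at hdet
    linear_combination hdet
  rcases mul_self_eq_one_iff.mp hcc with rfl | rfl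
  · left; apply Subtype.ext; rw [hc, one_smul]; rfl
  · right; apply Subtype.ext; rw [hc, neg_one_smul]; rfl

end IsIrreducibleRep

variable {G : Type*} [Group G]

theorem IsReducibleRep.trace_commutator {ρ : G →* SL2C} (hρ : IsReducibleRep ρ) {c : G}
    (hc : c ∈ commutator G) : character ρ c = 2 := by
  obtain ⟨v, hv, h⟩ := isReducibleRep_iff_exists_eigenvector.mp hρ
  choose k hk using h
  have hk0 : ∀ γ, k γ ≠ 0 := fun γ => DetOne.eigenvalue_ne_zero (det_matrixRep ρ γ) hv (hk γ)
  let S : Subgroup G :=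
    { carrier := {γ | matrixRep ρ γ *ᵥ v = v}
      one_mem' := by rw [Set.mem_ofPred_eq, map_one, one_mulVec]
      mul_mem' := fun {a b} ha hb => by
        simp only [Set.mem_ofPred_eq] at ha hb ⊢
        rw [map_mul, ← mulVec_mulVec, hb, ha]
      inv_mem' := fun {a} ha => by
        simp only [Set.mem_ofPred_eq] at ha ⊢
        nth_rw 1 [← ha]
        rw [mulVec_mulVec, ← map_mul, inv_mul_cancel, map_one, one_mulVec] }
  have hS : commutator G ≤ S := by
    rw [commutator_def, Subgroup.commutator_le]
    intro a _ b _
    have h1 : matrixRep ρ (b * a) *ᵥ v = (k a * k b) • v := by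
      rw [map_mul, ← mulVec_mulVec, hk, mulVec_smul, hk, smul_smul]
    have h2 : matrixRep ρ (a * b) *ᵥ v = (k a * k b) • v := by
      rw [map_mul, ← mulVec_mulVec, hk, mulVec_smul, hk, smul_smul,
        mul_comm]
    have h3 : a * b = ⁅a, b⁆ * (b * a) := by simp [commutatorElement_def, mul_assoc]
    rw [h3, map_mul, ← mulVec_mulVec, h1, mulVec_smul] at h2
    exact smul_right_injective _ (mul_ne_zero (hk0 a) (hk0 b)) h2
  have h1 : matrixRep ρ c *ᵥ v = (1 : ℂ) • v := by rw [one_smul]; exact hS hc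
  have := DetOne.trace_eq_of_eigenvector (det_matrixRep ρ _) hv h1
  rw [character_apply, this]; norm_num

/-- A representation whose character takes the value `2` on the commutator subgroup is reducible:
the elements of the commutator subgroup are mapped to unipotent matrices, which turn out to have a
common fixed vector. -/
theorem isReducibleRep_of_trace_commutator {ρ : G →* SL2C}
    (h : ∀ c ∈ commutator G, character ρ c = 2) : IsReducibleRep ρ := by
  by_contra hρ
  change IsIrreducibleRep ρ at hρ
  have htriv : ∀ c ∈ commutator G, ρ c = 1 := by
    by_contra! hex
    obtain ⟨c, hc, hc1⟩ := hex
    set N : Matrix (Fin 2) (Fin 2) ℂ := matrixRep ρ c - 1 with hNdef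
    have hN : N ≠ 0 := fun h0 => hc1 (Subtype.ext (sub_eq_zero.mp h0))
    -- the matrices in question are unipotent by the Cayley–Hamilton theorem
    have hsq : ∀ d ∈ commutator G, (matrixRep ρ d - 1) *
        (matrixRep ρ d - 1) = 0 := fun d hd => by
      have h2 := DetOne.mul_self_eq (det_matrixRep ρ d)
      have h3 : trace (matrixRep ρ d) = 2 := h d hd
      rw [h3] at h2
      rw [sub_mul, mul_sub, h2, mul_one, one_mul]
      module
    have hNdet : N.det = 0 := by
      have := congrArg det (hsq c hc)
      simpa using this
    -- `N X N = tr (N X) N` since `N` has rank one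
    have hNXN : ∀ X : Matrix (Fin 2) (Fin 2) ℂ, N * X * N = trace (N * X) • N := fun X => by
      rw [det_fin_two] at hNdet
      ext i j
      fin_cases i <;> fin_cases j <;>
        simp [Matrix.mul_apply, Fin.sum_univ_two, trace_fin_two]
      · linear_combination (-X 1 1) * hNdet
      · linear_combination (X 0 1) * hNdet
      · linear_combination (X 1 0) * hNdet
      · linear_combination (-X 0 0) * hNdet
    -- the kernel of `N` is the line spanned by `N x`; it is preserved by the nilpotent `N'` because
    -- `N N' N = tr (N N') N = 0`, and therefore annihilated by `N'`
    have hfix : ∀ d ∈ commutator G, ∀ x, matrixRep ρ d *ᵥ (N *ᵥ x) = N *ᵥ x := by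
      intro d hd x
      set N' : Matrix (Fin 2) (Fin 2) ℂ := matrixRep ρ d - 1 with hN'def
      have htr : trace (N * N') = 0 := by
        have h1 : trace (matrixRep ρ c * matrixRep ρ d) = 2 := by
          have := h _ (mul_mem hc hd)
          rwa [character_apply, map_mul] at this
        have h2 : trace (matrixRep ρ c) = 2 := h c hc
        have h3 : trace (matrixRep ρ d) = 2 := h d hd
        rw [hNdef, hN'def, sub_mul, mul_sub, trace_sub, trace_sub, h1]
        simp [h2, h3]
      have hz : N' *ᵥ (N *ᵥ x) = 0 := by
        by_contra hne
        have hy : N *ᵥ x ≠ 0 := fun h0 => hne (by rw [h0, mulVec_zero])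
        obtain ⟨k, hk⟩ := exists_smul_eq_of_mulVec_eq_zero hN hy
          (z := N' *ᵥ (N *ᵥ x)) (by rw [mulVec_mulVec, hsq c hc, zero_mulVec])
          (by rw [mulVec_mulVec, mulVec_mulVec, hNXN, htr]; simp)
        have hk' : k • (N' *ᵥ (N *ᵥ x)) = 0 := by
          rw [← mulVec_smul, ← hk, mulVec_mulVec, hsq d hd, zero_mulVec]
        rcases smul_eq_zero.mp hk' with h0 | h0
        · exact hne (by rw [hk, h0, zero_smul])
        · exact hne h0
      rw [hN'def, sub_mulVec, one_mulVec] at hz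
      exact sub_eq_zero.mp hz
    -- the common fixed vectors form an invariant subspace, as the commutator subgroup is normal
    let W : Submodule ℂ (Fin 2 → ℂ) :=
      { carrier := {w | ∀ d ∈ commutator G, matrixRep ρ d *ᵥ w = w}
        add_mem' := fun {a b} ha hb d hd => by rw [mulVec_add, ha d hd, hb d hd]
        zero_mem' := fun d _ => mulVec_zero _
        smul_mem' := fun k a ha d hd => by rw [mulVec_smul, ha d hd] }
    have hWtop : W = ⊤ := by
      refine hρ.eq_top_of_invariant W (fun γ w hw d hd => ?_) (fun hbot => hN ?_)
      · have h1 := hw (γ⁻¹ * d * γ) (by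
          simpa using (inferInstance : (commutator G).Normal).conj_mem d hd γ⁻¹)
        have h2 : d * γ = γ * (γ⁻¹ * d * γ) := by group
        rw [mulVec_mulVec, ← map_mul, h2, map_mul,
          ← mulVec_mulVec, h1]
      · apply Matrix.toLin'.map_eq_zero_iff.mp
        ext1 x
        have : N *ᵥ (Pi.single x 1) ∈ W := fun d hd => hfix d hd _
        rw [hbot, Submodule.mem_bot] at this
        ext i
        simpa using congrFun this i
    refine hc1 (Subtype.ext (Matrix.toLin'.injective (LinearMap.ext fun w => ?_)))
    have hw : w ∈ W := hWtop ▸ Submodule.mem_top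
    change matrixRep ρ c *ᵥ w = (1 : Matrix (Fin 2) (Fin 2) ℂ) *ᵥ w
    rw [one_mulVec]
    exact hw c hc
  -- the image of `ρ` is now abelian, hence scalar by Schur's lemma
  have hcomm : ∀ a b : G, ρ a * ρ b = ρ b * ρ a := fun a b => by
    have h1 := htriv ⁅a, b⁆ (Subgroup.commutator_mem_commutator (Subgroup.mem_top a)
      (Subgroup.mem_top b))
    have h3 : a * b = ⁅a, b⁆ * (b * a) := by simp [commutatorElement_def, mul_assoc]
    rw [← map_mul, h3, map_mul, h1, one_mul, map_mul]
  refine hρ (isReducibleRep_iff_exists_eigenvector.mpr ⟨![1, 0], by simp, fun γ => ?_⟩)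
  obtain ⟨c, hc⟩ := hρ.eq_smul_one_of_commute (B := matrixRep ρ γ)
    (fun δ => congrArg Subtype.val (hcomm γ δ))
  exact ⟨c, by rw [hc, smul_mulVec, one_mulVec]⟩

theorem isReducibleRep_iff_trace_commutator {ρ : G →* SL2C} :
    IsReducibleRep ρ ↔ ∀ c ∈ commutator G, character ρ c = 2 :=
  ⟨fun h _ hc => h.trace_commutator hc, isReducibleRep_of_trace_commutator⟩

theorem isReducibleRep_of_commute {ρ : G →* SL2C} (h : ∀ a b : G, Commute (ρ a) (ρ b)) :
    IsReducibleRep ρ := by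
  refine isReducibleRep_of_trace_commutator fun c hc => ?_
  have hle : commutator G ≤ ρ.ker := by
    rw [commutator_def, Subgroup.commutator_le]
    intro a _ b _
    rw [MonoidHom.mem_ker, map_commutatorElement, commutatorElement_eq_one_iff_commute]
    exact h a b
  rw [character, MonoidHom.mem_ker.mp (hle hc)]
  simp

/-- A reducible representation has the same character as a diagonal one. -/
theorem IsReducibleRep.exists_commute_character_eq {ρ : G →* SL2C} (hρ : IsReducibleRep ρ) :
    ∃ σ : G →* SL2C, (∀ a b : G, Commute (σ a) (σ b)) ∧ character ρ = character σ := by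
  obtain ⟨v, hv, h⟩ := isReducibleRep_iff_exists_eigenvector.mp hρ
  choose k hk using h
  have hk0 : ∀ γ, k γ ≠ 0 := fun γ => DetOne.eigenvalue_ne_zero (det_matrixRep ρ γ) hv (hk γ)
  have hmul : ∀ a b, k (a * b) = k a * k b := fun a b => by
    refine smul_left_injective ℂ hv ?_
    simp only
    rw [← hk, map_mul, ← mulVec_mulVec, hk, mulVec_smul, hk, smul_smul,
      mul_comm]
  have hone : k 1 = 1 := by
    have := hmul 1 1
    rw [mul_one] at this
    exact (mul_eq_left₀ (hk0 1)).mp this.symm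
  obtain ⟨σ, hσ⟩ := exists_matrixRep_eq
    { toFun := fun γ => diagonal ![k γ, (k γ)⁻¹]
      map_one' := by
        ext i j; fin_cases i <;> fin_cases j <;> simp [hone]
      map_mul' := fun a b => by
        rw [diagonal_mul_diagonal]
        congr 1
        ext i; fin_cases i <;> simp [hmul, mul_comm] }
    (fun γ => by simp [hk0])
  refine ⟨σ, fun a b => ?_, funext fun γ => ?_⟩
  · rw [commute_iff_eq, ← map_mul, ← map_mul]
    apply eq_of_matrixRep_eq
    rw [map_mul, map_mul, hσ]
    simp [diagonal_mul_diagonal, mul_comm]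
  · rw [character_apply, DetOne.trace_eq_of_eigenvector (det_matrixRep ρ _) hv (hk γ),
      character_apply, hσ]
    simp

/-! ### Irreducible representations are determined by their characters -/

/-- The linear extension of a representation to the group algebra. -/
noncomputable def groupAlgebraHom (ρ : G →* SL2C) :
    MonoidAlgebra ℂ G →ₐ[ℂ] Matrix (Fin 2) (Fin 2) ℂ :=
  MonoidAlgebra.lift ℂ _ G (matrixRep ρ)

theorem groupAlgebraHom_of (ρ : G →* SL2C) (γ : G) :
    groupAlgebraHom ρ (MonoidAlgebra.of ℂ G γ) = matrixRep ρ γ := by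
  simp [groupAlgebraHom]

theorem trace_groupAlgebraHom_congr {ρ σ : G →* SL2C} (h : character ρ = character σ)
    (a : MonoidAlgebra ℂ G) : trace (groupAlgebraHom ρ a) = trace (groupAlgebraHom σ a) := by
  induction a using MonoidAlgebra.induction_on with
  | of γ => rw [groupAlgebraHom_of, groupAlgebraHom_of]; exact congrFun h γ
  | add a b ha hb => rw [map_add, map_add, trace_add, trace_add, ha, hb]
  | smul c a ha => rw [map_smul, map_smul, trace_smul, trace_smul, ha]

namespace IsIrreducibleRep

variable {ρ : G →* SL2C}

theorem exists_groupAlgebraHom_mulVec_eq (hρ : IsIrreducibleRep ρ) {v : Fin 2 → ℂ} (hv : v ≠ 0)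
    (w : Fin 2 → ℂ) : ∃ a, groupAlgebraHom ρ a *ᵥ v = w := by
  let W : Submodule ℂ (Fin 2 → ℂ) :=
    { carrier := {w | ∃ a, groupAlgebraHom ρ a *ᵥ v = w}
      add_mem' := by
        rintro _ _ ⟨a, rfl⟩ ⟨b, rfl⟩
        exact ⟨a + b, by rw [map_add, add_mulVec]⟩
      zero_mem' := ⟨0, by rw [map_zero, zero_mulVec]⟩
      smul_mem' := by
        rintro c _ ⟨a, rfl⟩
        exact ⟨c • a, by rw [map_smul, smul_mulVec]⟩ }
  have hW : W = ⊤ := by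
    refine hρ.eq_top_of_invariant W ?_ fun hbot => hv ?_
    · rintro γ _ ⟨a, rfl⟩
      exact ⟨MonoidAlgebra.of ℂ G γ * a, by rw [map_mul, groupAlgebraHom_of, mulVec_mulVec]⟩
    · rw [← Submodule.mem_bot ℂ, ← hbot]
      exact ⟨1, by rw [map_one, one_mulVec]⟩
  exact (hW ▸ Submodule.mem_top : w ∈ W)

/-- The dual statement for row vectors: an invariant line of row vectors has an invariant line
as its annihilator. -/
theorem exists_vecMul_groupAlgebraHom_eq (hρ : IsIrreducibleRep ρ) {f : Fin 2 → ℂ} (hf : f ≠ 0)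
    (g : Fin 2 → ℂ) : ∃ a, f ᵥ* groupAlgebraHom ρ a = g := by
  let W : Submodule ℂ (Fin 2 → ℂ) :=
    { carrier := {w | ∃ a, f ᵥ* groupAlgebraHom ρ a = w}
      add_mem' := by
        rintro _ _ ⟨a, rfl⟩ ⟨b, rfl⟩
        exact ⟨a + b, by rw [map_add, vecMul_add]⟩
      zero_mem' := ⟨0, by rw [map_zero, vecMul_zero]⟩
      smul_mem' := by
        rintro c _ ⟨a, rfl⟩
        exact ⟨c • a, by rw [map_smul, vecMul_smul]⟩ }
  have hfW : f ∈ W := ⟨1, by rw [map_one, vecMul_one]⟩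
  let A : Submodule ℂ (Fin 2 → ℂ) :=
    { carrier := {v | ∀ w ∈ W, w ⬝ᵥ v = 0}
      add_mem' := fun {a b} ha hb w hw => by rw [dotProduct_add, ha w hw, hb w hw, add_zero]
      zero_mem' := fun w _ => dotProduct_zero w
      smul_mem' := fun c a ha w hw => by rw [dotProduct_smul, ha w hw, smul_zero] }
  have hA : ∀ γ, ∀ v ∈ A, matrixRep ρ γ *ᵥ v ∈ A := by
    rintro γ v hv _ ⟨a, rfl⟩
    rw [dotProduct_mulVec, vecMul_vecMul]
    exact hv _ ⟨a * MonoidAlgebra.of ℂ G γ, by rw [map_mul, groupAlgebraHom_of]⟩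
  have hAbot : A = ⊥ := by
    by_contra hne
    have htop := hρ.eq_top_of_invariant A hA hne
    refine hf (dotProduct_eq_zero f fun v => ?_)
    exact (htop ▸ Submodule.mem_top : v ∈ A) f hfW
  suffices hW : W = ⊤ from (hW ▸ Submodule.mem_top : g ∈ W)
  by_contra hne
  obtain ⟨φ, hφ, hφW⟩ := Submodule.exists_le_ker_of_lt_top W (lt_top_iff_ne_top.mpr hne)
  have hφeq : ∀ w, φ w = w ⬝ᵥ (fun i => φ (Pi.single i 1)) := fun w => by
    conv_lhs => rw [pi_eq_sum_univ' w]
    simp [dotProduct]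
  have hmem : (fun i => φ (Pi.single i 1)) ∈ A := fun w hw => by
    rw [← hφeq]; exact hφW hw
  rw [hAbot, Submodule.mem_bot] at hmem
  exact hφ (LinearMap.ext fun w => by rw [hφeq, hmem, dotProduct_zero]; rfl)

/-- **Burnside's theorem** for `2 × 2` matrices: an irreducible representation spans the matrix
algebra.  The span contains a matrix of rank one, and multiplying it from both sides gives all
matrices of rank one. -/
theorem groupAlgebraHom_surjective (hρ : IsIrreducibleRep ρ) :
    Function.Surjective (groupAlgebraHom ρ) := by
  obtain ⟨γ, hγ⟩ : ∃ γ, ∀ c : ℂ, matrixRep ρ γ ≠ c • 1 := by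
    by_contra! hsc
    refine hρ (isReducibleRep_iff_exists_eigenvector.mpr ⟨![1, 0], by simp, fun γ => ?_⟩)
    obtain ⟨c, hc⟩ := hsc γ
    exact ⟨c, by rw [hc, smul_mulVec, one_mulVec]⟩
  obtain ⟨c, v, hv, hcv⟩ := exists_eigenvector (matrixRep ρ γ)
  have hn : groupAlgebraHom ρ (MonoidAlgebra.of ℂ G γ - c • 1) = matrixRep ρ γ - c • 1 := by
    rw [map_sub, map_smul, map_one, groupAlgebraHom_of]
  set n := MonoidAlgebra.of ℂ G γ - c • (1 : MonoidAlgebra ℂ G)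
  set N := groupAlgebraHom ρ n with hNdef
  have hN : N ≠ 0 := by rw [hn]; exact sub_ne_zero.mpr (hγ c)
  have hdet : N.det = 0 := Matrix.exists_mulVec_eq_zero_iff.mp ⟨v, hv, by
    rw [hn, sub_mulVec, hcv, smul_mulVec, one_mulVec, sub_self]⟩
  obtain ⟨u, f, hNuf⟩ : ∃ u f : Fin 2 → ℂ, N = vecMulVec u f := exists_eq_vecMulVec hdet
  have hu : u ≠ 0 := by rintro rfl; exact hN (by rw [hNuf, zero_vecMulVec])
  have hf : f ≠ 0 := by rintro rfl; exact hN (by rw [hNuf, vecMulVec_zero])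
  have hrank : ∀ x y : Fin 2 → ℂ, ∃ a, groupAlgebraHom ρ a = vecMulVec x y := fun x y => by
    obtain ⟨a, ha⟩ := hρ.exists_groupAlgebraHom_mulVec_eq hu x
    obtain ⟨b, hb⟩ := hρ.exists_vecMul_groupAlgebraHom_eq hf y
    refine ⟨a * n * b, ?_⟩
    rw [map_mul, map_mul, ← hNdef, hNuf, mul_vecMulVec, vecMulVec_mul, ha, hb]
  intro M
  obtain ⟨a, ha⟩ := hrank ![1, 0] (M 0)
  obtain ⟨b, hb⟩ := hrank ![0, 1] (M 1)
  refine ⟨a + b, ?_⟩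
  rw [map_add, ha, hb]
  ext i j
  rw [Matrix.add_apply, vecMulVec_apply, vecMulVec_apply]
  fin_cases i <;> simp

/-- If `ρ a = 0`, then `σ a` is orthogonal to the whole matrix algebra for the trace form. -/
theorem ker_groupAlgebraHom_le {σ : G →* SL2C} (hσ : IsIrreducibleRep σ)
    (h : character ρ = character σ) {a : MonoidAlgebra ℂ G} (ha : groupAlgebraHom ρ a = 0) :
    groupAlgebraHom σ a = 0 := by
  refine Matrix.ext_iff_trace_mul_right.mpr fun X => ?_
  obtain ⟨b, rfl⟩ := hσ.groupAlgebraHom_surjective X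
  rw [← map_mul, ← trace_groupAlgebraHom_congr h, map_mul, ha]
  simp

/-- Two irreducible representations with the same character are conjugate. -/
theorem exists_conj_of_character_eq {σ : G →* SL2C} (hρ : IsIrreducibleRep ρ)
    (h : character ρ = character σ) : ∃ A : SL2C, ∀ γ, σ γ = A * ρ γ * A⁻¹ := by
  have hσ : IsIrreducibleRep σ := fun hred => hρ (isReducibleRep_iff_trace_commutator.mpr
    (h ▸ isReducibleRep_iff_trace_commutator.mp hred))
  have hker : RingHom.ker (groupAlgebraHom ρ) = RingHom.ker (groupAlgebraHom σ) := by
    ext a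
    exact ⟨hσ.ker_groupAlgebraHom_le h, hρ.ker_groupAlgebraHom_le h.symm⟩
  -- both representations identify the matrix algebra with the same quotient of the group algebra
  let e : Matrix (Fin 2) (Fin 2) ℂ ≃ₐ[ℂ] Matrix (Fin 2) (Fin 2) ℂ :=
    (Ideal.quotientKerAlgEquivOfSurjective hρ.groupAlgebraHom_surjective).symm.trans
      ((Ideal.quotientEquivAlgOfEq ℂ hker).trans
        (Ideal.quotientKerAlgEquivOfSurjective hσ.groupAlgebraHom_surjective))
  have he : ∀ γ, e (matrixRep ρ γ) = matrixRep σ γ := fun γ => by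
    have : (Ideal.quotientKerAlgEquivOfSurjective hρ.groupAlgebraHom_surjective).symm
        (matrixRep ρ γ) = Ideal.Quotient.mk _ (MonoidAlgebra.of ℂ G γ) := by
      rw [AlgEquiv.symm_apply_eq, ← groupAlgebraHom_of]
      rfl
    simp only [e, AlgEquiv.trans_apply, this]
    rw [← groupAlgebraHom_of]
    rfl
  obtain ⟨T, hT⟩ := ((toLinAlgEquiv'.symm.trans e).trans toLinAlgEquiv').eq_linearEquivConjAlgEquiv
  set B := LinearMap.toMatrix' (T : (Fin 2 → ℂ) →ₗ[ℂ] (Fin 2 → ℂ))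
  have hB : B.det ≠ 0 := by
    have : B * LinearMap.toMatrix' (T.symm : (Fin 2 → ℂ) →ₗ[ℂ] (Fin 2 → ℂ)) = 1 := by
      rw [← LinearMap.toMatrix'_comp, LinearEquiv.comp_coe]
      simp
    have hdet := congrArg det this
    rw [det_mul, det_one] at hdet
    exact left_ne_zero_of_mul_eq_one hdet
  have hconj : ∀ γ, matrixRep σ γ * B = B * matrixRep ρ γ := fun γ => by
    apply Matrix.toLin'.injective
    have h1 := AlgEquiv.congr_fun hT (toLinAlgEquiv' (matrixRep ρ γ))
    simp only [AlgEquiv.trans_apply, AlgEquiv.symm_apply_apply, he] at h1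
    rw [toLin'_mul, toLin'_mul, toLin'_toMatrix']
    refine LinearMap.ext fun x => ?_
    have h2 := LinearMap.congr_fun h1 (T x)
    rw [LinearEquiv.conjAlgEquiv_apply] at h2
    simpa using h2
  -- a square root of the determinant is needed to rescale `B` to determinant one
  obtain ⟨s, hs⟩ := IsAlgClosed.exists_eq_mul_self B.det
  have hs0 : s ≠ 0 := by rintro rfl; exact hB (by simpa using hs)
  refine ⟨⟨s⁻¹ • B, ?_⟩, fun γ => eq_mul_inv_of_mul_eq (Subtype.ext ?_)⟩
  · rw [det_smul, Fintype.card_fin, hs]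
    field_simp
  · change matrixRep σ γ * (s⁻¹ • B) = (s⁻¹ • B) * matrixRep ρ γ
    rw [mul_smul_comm, smul_mul_assoc, hconj]

end IsIrreducibleRep

end Representations

/-! ### Extensions by a cyclic group of odd order -/

section OddCyclicExtension

open Matrix

/-- `G` is an extension of a cyclic group of odd order by `P`: the map `i` identifies `P` with the
kernel of `e`, and the range of `e` is the cyclic group generated by `e m`, of odd order. -/
structure IsOddCyclicExtension {P G C : Type*} [Group P] [Group G] [Group C]
    (i : P →* G) (e : G →* C) (m : G) : Prop where
  injective : Function.Injective i
  range_eq_ker : i.range = e.ker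
  mem_zpowers : ∀ g, e g ∈ Subgroup.zpowers (e m)
  odd_orderOf : Odd (orderOf (e m))

namespace SL2C

theorem neg_ne_self (X : SL2C) : -X ≠ X := fun h => by
  have h1 : (-X).1 = X.1 := congrArg Subtype.val h
  have h2 : X.1 = 0 := by
    rw [SpecialLinearGroup.coe_neg, neg_eq_iff_add_eq_zero, ← two_smul ℂ] at h1
    exact (smul_eq_zero.mp h1).resolve_left two_ne_zero
  have h3 := X.2
  rw [h2, det_zero] at h3
  exact zero_ne_one h3

end SL2C

theorem character_conj {G : Type*} [Group G] (A : SL2C) (σ : G →* SL2C) :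
    character ((MulAut.conj A).toMonoidHom.comp σ) = character σ := by
  funext γ
  change trace (A.1 * (σ γ).1 * (A⁻¹).1) = trace (σ γ).1
  have hA : (A⁻¹).1 * A.1 = 1 := congrArg Subtype.val (inv_mul_cancel A)
  rw [trace_mul_comm, ← Matrix.mul_assoc, hA, Matrix.one_mul]

namespace IsOddCyclicExtension

variable {P G C : Type*} [Group P] [Group G] [Group C] {i : P →* G} {e : G →* C} {m : G}

theorem exists_eq_of_map_eq_one (h : IsOddCyclicExtension i e m) {g : G} (hg : e g = 1) :
    ∃ x, i x = g := by
  have : g ∈ i.range := h.range_eq_ker ▸ hg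
  exact this

theorem map_apply (h : IsOddCyclicExtension i e m) (x : P) : e (i x) = 1 := by
  have : i x ∈ e.ker := h.range_eq_ker ▸ ⟨x, rfl⟩
  exact this

theorem exists_eq_mul_zpow (h : IsOddCyclicExtension i e m) (g : G) :
    ∃ (x : P) (k : ℤ), g = i x * m ^ k := by
  obtain ⟨k, hk⟩ := h.mem_zpowers g
  obtain ⟨x, hx⟩ := h.exists_eq_of_map_eq_one (g := g * (m ^ k)⁻¹)
    (by simp only [map_mul, map_inv, map_zpow]; simp only at hk; rw [hk, mul_inv_cancel])
  exact ⟨x, k, by rw [hx, inv_mul_cancel_right]⟩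

theorem exists_conj_eq (h : IsOddCyclicExtension i e m) (g : G) (x : P) :
    ∃ y, i y = g * i x * g⁻¹ :=
  h.exists_eq_of_map_eq_one (by simp [h.map_apply])

theorem exists_eq_pow (h : IsOddCyclicExtension i e m) : ∃ y, i y = m ^ orderOf (e m) :=
  h.exists_eq_of_map_eq_one (by rw [map_pow, pow_orderOf_eq_one])

/-- Two extensions of an irreducible representation differ by a character of the cyclic quotient
with values `± 1`, which is trivial since the order is odd. -/
theorem eq_of_comp_eq (h : IsOddCyclicExtension i e m) {σ₁ σ₂ : G →* SL2C}
    (hirr : IsIrreducibleRep (σ₁.comp i)) (heq : σ₁.comp i = σ₂.comp i) : σ₁ = σ₂ := by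
  have hi : ∀ x, σ₁ (i x) = σ₂ (i x) := fun x => DFunLike.congr_fun heq x
  have hm : σ₁ m = σ₂ m := by
    have hcomm : ∀ x, (σ₁ m)⁻¹ * σ₂ m * (σ₁.comp i) x = (σ₁.comp i) x * ((σ₁ m)⁻¹ * σ₂ m) := by
      intro x
      obtain ⟨y, hy⟩ := h.exists_conj_eq m x
      have h1 : σ₁ m * σ₁ (i x) * (σ₁ m)⁻¹ = σ₂ m * σ₁ (i x) * (σ₂ m)⁻¹ := by
        rw [← map_inv, ← map_mul, ← map_mul, ← hy, hi y, hy, map_mul, map_mul, ← hi x, map_inv]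
      rw [MonoidHom.comp_apply]
      calc (σ₁ m)⁻¹ * σ₂ m * σ₁ (i x)
          = (σ₁ m)⁻¹ * (σ₂ m * σ₁ (i x) * (σ₂ m)⁻¹) * σ₂ m := by group
        _ = (σ₁ m)⁻¹ * (σ₁ m * σ₁ (i x) * (σ₁ m)⁻¹) * σ₂ m := by rw [h1]
        _ = σ₁ (i x) * ((σ₁ m)⁻¹ * σ₂ m) := by group
    rcases hirr.eq_one_or_neg_one_of_commute hcomm with h1 | h1
    · exact inv_mul_eq_one.mp h1
    · exfalso
      have h2 : σ₂ m = -σ₁ m := by rw [eq_mul_of_inv_mul_eq h1, mul_neg, mul_one]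
      obtain ⟨y, hy⟩ := h.exists_eq_pow
      have h3 := hi y
      rw [hy, map_pow, map_pow, h2, h.odd_orderOf.neg_pow] at h3
      exact SL2C.neg_ne_self _ h3.symm
  ext1 g
  obtain ⟨x, k, rfl⟩ := h.exists_eq_mul_zpow g
  rw [map_mul, map_mul, map_zpow, map_zpow, hi, hm]

/-- The restriction of an irreducible representation to `P` is irreducible.  If `v` is a common
eigenvector for `P`, so is `M v`, where `M` is the image of `m`; since `P` has no common
eigenvector that is also one of `M`, the vectors `v` and `M v` form a basis.  Either `P` acts by
scalars, or `M` has trace zero, so that `M² = -1`, and then `M v` is up to sign `Mᵈ v` for the odd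
order `d` of the quotient, which is a multiple of `v` as `mᵈ` is in `P`. -/
theorem isIrreducibleRep_comp (h : IsOddCyclicExtension i e m) {σ : G →* SL2C}
    (hσ : IsIrreducibleRep σ) : IsIrreducibleRep (σ.comp i) := by
  intro hred
  -- a common eigenvector of `P` and `m` is one of `G`
  have hgen : ∀ v : Fin 2 → ℂ, v ≠ 0 → (∀ x, ∃ c : ℂ, matrixRep σ (i x) *ᵥ v = c • v) →
      (∃ c : ℂ, matrixRep σ m *ᵥ v = c • v) → False := by
    rintro v hv hP ⟨c, hc⟩
    refine hσ (isReducibleRep_iff_exists_eigenvector.mpr ⟨v, hv, ?_⟩)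
    let S : Subgroup G :=
      { carrier := {g | ∃ c : ℂ, matrixRep σ g *ᵥ v = c • v}
        one_mem' := ⟨1, by rw [map_one, one_mulVec, one_smul]⟩
        mul_mem' := by
          rintro a b ⟨k, hk⟩ ⟨l, hl⟩
          exact ⟨l * k, by rw [map_mul, ← mulVec_mulVec, hl, mulVec_smul, hk, smul_smul]⟩
        inv_mem' := by
          rintro a ⟨k, hk⟩
          have hk0 := DetOne.eigenvalue_ne_zero (det_matrixRep σ a) hv hk
          refine ⟨k⁻¹, ?_⟩
          rw [eq_inv_smul_iff₀ hk0, ← mulVec_smul, ← hk, mulVec_mulVec, ← map_mul,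
            inv_mul_cancel, map_one, one_mulVec] }
    intro g
    obtain ⟨x, k, rfl⟩ := h.exists_eq_mul_zpow g
    exact S.mul_mem (hP x) (S.zpow_mem ⟨c, hc⟩ k)
  obtain ⟨v, hv, hP⟩ := isReducibleRep_iff_exists_eigenvector.mp hred
  replace hP : ∀ x, ∃ c : ℂ, matrixRep σ (i x) *ᵥ v = c • v := hP
  set M := matrixRep σ m with hM
  have hind : ∀ a b : ℂ, a • v + b • (M *ᵥ v) = 0 → a = 0 ∧ b = 0 := by
    intro a b hab
    have hb : b = 0 := by
      by_contra hb
      refine hgen v hv hP ⟨-(b⁻¹ * a), ?_⟩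
      rw [neg_smul, mul_smul, ← smul_neg, eq_inv_smul_iff₀ hb]
      exact (neg_eq_of_add_eq_zero_right hab).symm
    subst hb
    rw [zero_smul, add_zero] at hab
    exact ⟨(smul_eq_zero.mp hab).resolve_right hv, rfl⟩
  have hshift : ∀ w : Fin 2 → ℂ, (∀ x, ∃ c : ℂ, matrixRep σ (i x) *ᵥ w = c • w) →
      ∀ x, ∃ c : ℂ, matrixRep σ (i x) *ᵥ (M *ᵥ w) = c • (M *ᵥ w) := by
    intro w hw x
    obtain ⟨y, hy⟩ := h.exists_conj_eq m⁻¹ x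
    obtain ⟨c, hc⟩ := hw y
    refine ⟨c, ?_⟩
    rw [← mulVec_smul, ← hc, mulVec_mulVec, mulVec_mulVec, hM, ← map_mul, ← map_mul, hy]
    congr 2
    group
  have hMM : ∀ w, M *ᵥ (M *ᵥ w) = trace M • (M *ᵥ w) - w := fun w => by
    rw [mulVec_mulVec, DetOne.mul_self_eq (det_matrixRep σ m), sub_mulVec, smul_mulVec, one_mulVec]
  by_cases htr : trace M = 0
  · have hodd : ∀ k : ℕ, ∃ s : ℂ, s ≠ 0 ∧ M ^ (2 * k + 1) *ᵥ v = s • (M *ᵥ v) := by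
      intro k
      induction k with
      | zero => exact ⟨1, one_ne_zero, by simp⟩
      | succ k ih =>
        obtain ⟨s, hs, ih⟩ := ih
        refine ⟨-s, neg_ne_zero.mpr hs, ?_⟩
        rw [show 2 * (k + 1) + 1 = 1 + 1 + (2 * k + 1) by ring, pow_add, pow_add, pow_one,
          ← mulVec_mulVec, ih, ← mulVec_mulVec, mulVec_smul, mulVec_smul, hMM, htr, zero_smul,
          zero_sub, smul_neg, neg_smul]
    obtain ⟨k, hk⟩ := h.odd_orderOf
    obtain ⟨s, hs, hsk⟩ := hodd k
    obtain ⟨y, hy⟩ := h.exists_eq_pow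
    obtain ⟨c, hc⟩ := hP y
    rw [hy, hk, map_pow, hsk] at hc
    refine hs (hind (-c) s ?_).2
    rw [hc, neg_smul, neg_add_cancel]
  · -- `v`, `M v` and `M² v` span three distinct lines that are invariant under `P`
    have hscal : ∀ x, ∃ c : ℂ, ∀ w, matrixRep σ (i x) *ᵥ w = c • w := by
      intro x
      obtain ⟨a, ha⟩ := hP x
      obtain ⟨b, hb⟩ := hshift v hP x
      obtain ⟨c, hc⟩ := hshift _ (hshift v hP) x
      rw [hMM, mulVec_sub, mulVec_smul, ha, hb] at hc
      obtain ⟨h1, h2⟩ := hind (c - a) (trace M * b - c * trace M) (by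
        rw [← sub_eq_zero] at hc
        rw [← hc]
        module)
      have hca : c = a := sub_eq_zero.mp h1
      have hba : b = a := by
        apply mul_left_cancel₀ htr
        rw [← hca]
        linear_combination h2
      refine ⟨a, fun w => ?_⟩
      have hspan : Submodule.span ℂ (Set.range ![v, M *ᵥ v]) = ⊤ :=
        (LinearIndependent.pair_iff.mpr hind).span_eq_top_of_card_eq_finrank' (by simp)
      have hw : ∃ s t : ℂ, s • v + t • (M *ᵥ v) = w := by
        rw [← Submodule.mem_span_pair, ← Matrix.range_cons_cons_empty v (M *ᵥ v) ![], hspan]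
        exact Submodule.mem_top
      obtain ⟨s, t, rfl⟩ := hw
      rw [mulVec_add, mulVec_smul, mulVec_smul, ha, hb, hba]
      module
    obtain ⟨c, w, hw, hcw⟩ := exists_eigenvector M
    exact hgen w hw (fun x => (hscal x).imp fun c hc => hc w) ⟨c, hcw⟩

theorem zpow_conj (h : IsOddCyclicExtension i e m) {ρ : P →* SL2C} {A : SL2C}
    {c : P →* P} (hc : ∀ x, i (c x) = m * i x * m⁻¹) (hA : ∀ x, ρ (c x) = A * ρ x * A⁻¹)
    (k : ℤ) (x z : P) (hz : i z = m ^ k * i x * (m ^ k)⁻¹) :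
    ρ z = A ^ k * ρ x * (A ^ k)⁻¹ := by
  have hnat : ∀ (n : ℕ) (x z : P), i z = m ^ n * i x * (m ^ n)⁻¹ →
      ρ z = A ^ n * ρ x * (A ^ n)⁻¹ := by
    intro n
    induction n with
    | zero =>
      intro x z hz
      have : z = x := h.injective (by simpa using hz)
      simp [this]
    | succ n ih =>
      intro x z hz
      have h1 := ih (c x) z (by rw [hz, hc, pow_succ]; group)
      rw [h1, hA, pow_succ]
      group
  obtain ⟨n, rfl | rfl⟩ := k.eq_nat_or_neg
  · rw [zpow_natCast] at hz ⊢
    exact hnat n x z hz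
  · have h1 := hnat n z x (by rw [hz, _root_.zpow_neg, zpow_natCast]; group)
    rw [h1, _root_.zpow_neg, zpow_natCast]
    group

/-- The rule `i x * mᵏ ↦ ρ x * Aᵏ` extends a representation `ρ` of `P` to `G`. -/
theorem exists_extension_of_pow_eq (h : IsOddCyclicExtension i e m) {ρ : P →* SL2C} {A : SL2C}
    {c : P →* P} (hc : ∀ x, i (c x) = m * i x * m⁻¹) (hA : ∀ x, ρ (c x) = A * ρ x * A⁻¹)
    {y : P} (hy : i y = m ^ orderOf (e m)) (hAy : A ^ orderOf (e m) = ρ y) :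
    ∃ σ : G →* SL2C, σ.comp i = ρ := by
  have hpow := h.zpow_conj hc hA
  have hwd : ∀ (x x' : P) (k k' : ℤ), i x * m ^ k = i x' * m ^ k' →
      ρ x * A ^ k = ρ x' * A ^ k' := by
    intro x x' k k' hxk
    have h1 : i (x'⁻¹ * x) = m ^ (k' - k) := by
      rw [map_mul, map_inv, _root_.zpow_sub, inv_mul_eq_iff_eq_mul, ← mul_assoc, ← hxk]
      group
    obtain ⟨j, hj⟩ : (orderOf (e m) : ℤ) ∣ k' - k := by
      rw [orderOf_dvd_iff_zpow_eq_one, ← map_zpow, ← h1, h.map_apply]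
    have h2 : x'⁻¹ * x = y ^ j := h.injective (by
      rw [h1, hj, map_zpow, hy, _root_.zpow_mul, zpow_natCast])
    have h3 : (ρ x')⁻¹ * ρ x = A ^ (k' - k) := by
      rw [← map_inv, ← map_mul, h2, map_zpow, ← hAy, hj, _root_.zpow_mul, zpow_natCast]
    rw [inv_mul_eq_iff_eq_mul.mp h3, mul_assoc, ← _root_.zpow_add, sub_add_cancel]
  choose x k hxk using h.exists_eq_mul_zpow
  have hmul : ∀ a b, ρ (x (a * b)) * A ^ k (a * b) = ρ (x a) * A ^ k a * (ρ (x b) * A ^ k b) := by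
    intro a b
    obtain ⟨z, hz⟩ := h.exists_conj_eq (m ^ k a) (x b)
    have h1 := hpow _ _ _ hz
    calc ρ (x (a * b)) * A ^ k (a * b) = ρ (x a * z) * A ^ (k a + k b) := by
          refine hwd _ _ _ _ ?_
          rw [← hxk, map_mul, hz, _root_.zpow_add]
          conv_lhs => rw [hxk a, hxk b]
          group
      _ = _ := by rw [map_mul, h1, _root_.zpow_add]; group
  refine ⟨MonoidHom.mk' (fun g => ρ (x g) * A ^ k g) hmul, MonoidHom.ext fun z => ?_⟩
  have := hwd (x (i z)) z (k (i z)) 0 (by rw [← hxk, zpow_zero, mul_one])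
  rw [zpow_zero, mul_one] at this
  exact this

/-- An irreducible representation of `P` whose character is invariant under conjugation by `m`
extends uniquely to `G`. -/
theorem existsUnique_extension (h : IsOddCyclicExtension i e m) {ρ : P →* SL2C}
    (hρ : IsIrreducibleRep ρ) {c : P →* P} (hc : ∀ x, i (c x) = m * i x * m⁻¹)
    (hinv : ∀ x, character ρ (c x) = character ρ x) : ∃! σ : G →* SL2C, σ.comp i = ρ := by
  obtain ⟨A, hA⟩ := hρ.exists_conj_of_character_eq (σ := ρ.comp c) (funext fun x => (hinv x).symm)
  replace hA : ∀ x, ρ (c x) = A * ρ x * A⁻¹ := hA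
  obtain ⟨y, hy⟩ := h.exists_eq_pow
  have hex : ∃ σ : G →* SL2C, σ.comp i = ρ := by
    have hcomm : ∀ x, (ρ y)⁻¹ * A ^ orderOf (e m) * ρ x =
        ρ x * ((ρ y)⁻¹ * A ^ orderOf (e m)) := by
      intro x
      have h1 := h.zpow_conj hc hA (orderOf (e m)) x (y * x * y⁻¹) (by
        rw [zpow_natCast, ← hy, map_mul, map_mul, map_inv])
      rw [zpow_natCast, map_mul, map_mul, map_inv] at h1
      calc (ρ y)⁻¹ * A ^ orderOf (e m) * ρ x
          = (ρ y)⁻¹ * (A ^ orderOf (e m) * ρ x * (A ^ orderOf (e m))⁻¹) * A ^ orderOf (e m) := by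
            group
        _ = (ρ y)⁻¹ * (ρ y * ρ x * (ρ y)⁻¹) * A ^ orderOf (e m) := by rw [h1]
        _ = _ := by group
    rcases hρ.eq_one_or_neg_one_of_commute hcomm with h1 | h1
    · exact h.exists_extension_of_pow_eq hc hA hy (inv_mul_eq_one.mp h1).symm
    · -- the odd order allows the sign of `A` to be adjusted
      refine h.exists_extension_of_pow_eq (A := -A) hc (fun x => ?_) hy ?_
      · rw [hA x, inv_neg, neg_mul, neg_mul_neg]
      · rw [h.odd_orderOf.neg_pow, eq_mul_of_inv_mul_eq h1, mul_neg, mul_one, neg_neg]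
  obtain ⟨σ, hσ⟩ := hex
  exact ⟨σ, hσ, fun τ hτ => h.eq_of_comp_eq (hτ.symm ▸ hρ) (hτ.trans hσ.symm)⟩

/-- An irreducible character of `G` is determined by its restriction to `P`. -/
theorem character_eq_of_comp (h : IsOddCyclicExtension i e m) {σ τ : G →* SL2C}
    (hσ : IsIrreducibleRep σ) (heq : character (σ.comp i) = character (τ.comp i)) :
    character σ = character τ := by
  obtain ⟨A, hA⟩ := (h.isIrreducibleRep_comp hσ).exists_conj_of_character_eq heq
  have hτ : ((MulAut.conj A).toMonoidHom.comp σ).comp i = τ.comp i :=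
    MonoidHom.ext fun x => (hA x).symm
  have hirr : IsIrreducibleRep (((MulAut.conj A).toMonoidHom.comp σ).comp i) := by
    rw [hτ]
    exact fun hred => h.isIrreducibleRep_comp hσ (isReducibleRep_iff_trace_commutator.mpr
      (heq ▸ isReducibleRep_iff_trace_commutator.mp hred))
  rw [← h.eq_of_comp_eq hirr hτ]
  exact (character_conj A σ).symm

end IsOddCyclicExtension

end OddCyclicExtension

/-! ### Irreducible characters and irreducible components -/

namespace CharacterVariety

variable {G H : Type*} [Group G] [Group H]

theorem ofRep_mem_irreducibleCharacters_iff {ρ : G →* SL2C} :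
    ofRep ρ ∈ irreducibleCharacters G ↔ IsIrreducibleRep ρ := by
  refine ⟨?_, fun h => ⟨ρ, h, rfl⟩⟩
  rintro ⟨σ, hσ, h⟩ hred
  have hchar : character ρ = character σ := congrArg toFun h
  exact hσ (isReducibleRep_iff_trace_commutator.mpr
    (hchar ▸ isReducibleRep_iff_trace_commutator.mp hred))

theorem exists_ofRep_eq (χ : CharacterVariety G) : ∃ ρ, ofRep ρ = χ := by
  obtain ⟨ρ, hρ⟩ := χ.exists_rep
  exact ⟨ρ, CharacterVariety.ext hρ⟩

theorem abelianCharacters_eq_compl :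
    abelianCharacters G = (irreducibleCharacters G)ᶜ := by
  ext χ
  constructor
  · rintro ⟨ρ, hρ, rfl⟩ hirr
    exact ofRep_mem_irreducibleCharacters_iff.mp hirr (isReducibleRep_of_commute hρ)
  · intro hχ
    obtain ⟨ρ, rfl⟩ := χ.exists_ofRep_eq
    have hred : IsReducibleRep ρ := by
      by_contra hirr
      exact hχ (ofRep_mem_irreducibleCharacters_iff.mpr hirr)
    obtain ⟨σ, hσ, h⟩ := hred.exists_commute_character_eq
    exact ⟨σ, hσ, CharacterVariety.ext h⟩

theorem not_subset_abelianCharacters_iff {Z : Set (CharacterVariety G)} :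
    ¬ Z ⊆ abelianCharacters G ↔ (Z ∩ irreducibleCharacters G).Nonempty := by
  rw [abelianCharacters_eq_compl, Set.subset_compl_iff_disjoint_right, Set.not_disjoint_iff]
  rfl

theorem isOpen_ne_zero (f : MvPolynomial G ℂ) :
    IsOpen {χ : CharacterVariety G | MvPolynomial.eval χ.toFun f ≠ 0} :=
  TopologicalSpace.isOpen_generateFrom_of_mem ⟨f, rfl⟩

theorem isOpen_irreducibleCharacters : IsOpen (irreducibleCharacters G) := by
  have h : irreducibleCharacters G = ⋃ c ∈ commutator G, {χ : CharacterVariety G |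
      MvPolynomial.eval χ.toFun (MvPolynomial.X c - MvPolynomial.C 2) ≠ 0} := by
    ext χ
    obtain ⟨ρ, rfl⟩ := χ.exists_ofRep_eq
    rw [ofRep_mem_irreducibleCharacters_iff, IsIrreducibleRep, isReducibleRep_iff_trace_commutator]
    simp [ofRep, sub_eq_zero]
  rw [h]
  exact isOpen_biUnion fun c _ => isOpen_ne_zero _

theorem continuous_pullback (f : H →* G) : Continuous (pullback f) := by
  refine continuous_generateFrom_iff.mpr ?_
  rintro _ ⟨q, rfl⟩
  convert isOpen_ne_zero (MvPolynomial.rename f q) using 1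
  ext χ
  simp [MvPolynomial.eval_rename, pullback, Function.comp_def]

theorem exists_component_superset {A T : Set (CharacterVariety G)} (hTA : T ⊆ A)
    (hT : IsIrreducible T) : ∃ Z ∈ components A, T ⊆ Z := by
  obtain ⟨Z, hTZ, hZ⟩ := zorn_subset_nonempty {S | S ⊆ A ∧ IsIrreducible S} (by
    rintro C hC hchain ⟨S₀, hS₀⟩
    refine ⟨⋃₀ C, ⟨Set.sUnion_subset fun S hS => (hC hS).1, ?_, ?_⟩,
      fun S hS => Set.subset_sUnion_of_mem hS⟩
    · obtain ⟨χ, hχ⟩ := (hC hS₀).2.nonempty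
      exact ⟨χ, S₀, hS₀, hχ⟩
    · rintro U V hU hV ⟨x, ⟨S, hS, hxS⟩, hxU⟩ ⟨y, ⟨S', hS', hyS'⟩, hyV⟩
      obtain ⟨R, hR, hSR, hSR'⟩ := hchain.directedOn S hS S' hS'
      obtain ⟨z, hz, hzUV⟩ := (hC hR).2.isPreirreducible U V hU hV ⟨x, hSR hxS, hxU⟩
        ⟨y, hSR' hyS', hyV⟩
      exact ⟨z, ⟨R, hR, hz⟩, hzUV⟩) T ⟨hTA, hT⟩
  exact ⟨Z, hZ, hTZ⟩

/-- An irreducible subset of `A` that contains an irreducible character lies in a component of `A`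
that is not contained in `𝐗_ab`. -/
theorem subset_nonabelianPart {A T : Set (CharacterVariety G)} (hTA : T ⊆ A)
    (hT : IsIrreducible T) (hne : (T ∩ irreducibleCharacters G).Nonempty) :
    T ⊆ nonabelianPart A := by
  obtain ⟨Z, hZ, hTZ⟩ := exists_component_superset hTA hT
  exact hTZ.trans (Set.subset_sUnion_of_mem ⟨hZ, not_subset_abelianCharacters_iff.mpr
    (hne.mono (Set.inter_subset_inter_left _ hTZ))⟩)

theorem nonabelianPart_subset (A : Set (CharacterVariety G)) : nonabelianPart A ⊆ A :=
  Set.sUnion_subset fun _ hZ => hZ.1.1.1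

theorem nonabelianPart_inter_irreducibleCharacters (A : Set (CharacterVariety G)) :
    nonabelianPart A ∩ irreducibleCharacters G = A ∩ irreducibleCharacters G := by
  refine Set.Subset.antisymm (Set.inter_subset_inter_left _ (nonabelianPart_subset A)) ?_
  rintro χ ⟨hA, hχ⟩
  exact ⟨subset_nonabelianPart (Set.singleton_subset_iff.mpr hA) isIrreducible_singleton
    ⟨χ, rfl, hχ⟩ rfl, hχ⟩

theorem mainPart_inter_irreducibleCharacters :
    mainPart G ∩ irreducibleCharacters G = irreducibleCharacters G := by
  rw [mainPart, nonabelianPart_inter_irreducibleCharacters, Set.univ_inter]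

theorem irreducibleCharacters_subset_mainPart : irreducibleCharacters G ⊆ mainPart G :=
  Set.inter_eq_right.mp mainPart_inter_irreducibleCharacters

end CharacterVariety

/-! ### Restriction of characters to a subgroup with odd cyclic quotient -/

section Restriction

open CharacterVariety

variable {P G C : Type*} [Group P] [Group G] [Group C] {i : P →* G} {e : G →* C} {m : G}

theorem CharacterVariety.pullback_ofRep (f : P →* G) (ρ : G →* SL2C) :
    pullback f (ofRep ρ) = ofRep (ρ.comp f) := rfl

theorem CharacterVariety.pullback_eq_of_conj {c : P →* P} (hc : ∀ x, i (c x) = m * i x * m⁻¹)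
    (χ : CharacterVariety G) : pullback c (pullback i χ) = pullback i χ := by
  obtain ⟨ρ, rfl⟩ := χ.exists_ofRep_eq
  rw [pullback_ofRep, pullback_ofRep]
  have h : (ρ.comp i).comp c = (MulAut.conj (ρ m)).toMonoidHom.comp (ρ.comp i) :=
    MonoidHom.ext fun x => by simp [hc]
  exact CharacterVariety.ext ((congrArg character h).trans (character_conj _ _))

namespace IsOddCyclicExtension

theorem pullback_mem_irreducibleCharacters (h : IsOddCyclicExtension i e m)
    {χ : CharacterVariety G} (hχ : χ ∈ irreducibleCharacters G) :
    pullback i χ ∈ irreducibleCharacters P := by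
  obtain ⟨ρ, hρ, rfl⟩ := hχ
  exact ⟨ρ.comp i, h.isIrreducibleRep_comp hρ, rfl⟩

/-- The image of an irreducible component of `𝐗(G)` that contains an irreducible character is
irreducible and contains an irreducible character of `P`. -/
theorem mapsTo_pullback_mainPart (h : IsOddCyclicExtension i e m)
    {F : Set (CharacterVariety P)} (hF : ∀ χ, pullback i χ ∈ mainPart P → pullback i χ ∈ F) :
    Set.MapsTo (pullback i) (mainPart G) (nonabelianPart F) := by
  rintro χ ⟨Z, ⟨hZ, hZab⟩, hχ⟩
  obtain ⟨χ₀, hχ₀, hirr⟩ := not_subset_abelianCharacters_iff.mp hZab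
  have hirrZ : IsIrreducible (pullback i '' Z) :=
    hZ.1.2.image _ (continuous_pullback i).continuousOn
  have hne : (pullback i '' Z ∩ irreducibleCharacters P).Nonempty :=
    ⟨_, ⟨χ₀, hχ₀, rfl⟩, h.pullback_mem_irreducibleCharacters hirr⟩
  have hmain : pullback i '' Z ⊆ mainPart P :=
    subset_nonabelianPart (Set.subset_univ _) hirrZ hne
  refine subset_nonabelianPart ?_ hirrZ hne ⟨χ, hχ, rfl⟩
  rintro _ ⟨ξ, hξ, rfl⟩
  exact hF ξ (hmain ⟨ξ, hξ, rfl⟩)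

theorem bijOn_pullback (h : IsOddCyclicExtension i e m) {c : P →* P}
    (hc : ∀ x, i (c x) = m * i x * m⁻¹) :
    Set.BijOn (pullback i) (irreducibleCharacters G)
      ({χ | pullback c χ = χ} ∩ irreducibleCharacters P) := by
  refine ⟨fun χ hχ => ⟨pullback_eq_of_conj hc χ, h.pullback_mem_irreducibleCharacters hχ⟩, ?_, ?_⟩
  · rintro _ ⟨ρ, hρ, rfl⟩ _ ⟨σ, hσ, rfl⟩ heq
    exact CharacterVariety.ext (h.character_eq_of_comp hρ (congrArg toFun heq))
  · rintro _ ⟨hinv, ρ, hρ, rfl⟩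
    obtain ⟨σ, hσ, -⟩ := h.existsUnique_extension hρ hc
      (fun x => congrFun (congrArg toFun hinv) x)
    refine ⟨ofRep σ, ofRep_mem_irreducibleCharacters_iff.mpr fun hred => hρ ?_, ?_⟩
    · obtain ⟨W, hW, hinvW⟩ := hred
      exact ⟨W, hW, fun x => hσ ▸ hinvW (i x)⟩
    · rw [pullback_ofRep, hσ]

end IsOddCyclicExtension

end Restriction

/-! ### The orbifold fundamental group as an extension -/

section OrbifoldExtension

variable {X : Type*} [TopologicalSpace X]

namespace OrbifoldGroup

variable {Γ : Subgroup (X ≃ₜ X)} {x₀ : X}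

/-- The projection of the orbifold fundamental group of `X/Γ` to `Γ`. -/
noncomputable def eltHom (Γ : Subgroup (X ≃ₜ X)) (x₀ : X) : OrbifoldGroup Γ x₀ →* Γ where
  toFun a := a.elt
  map_one' := rfl
  map_mul' _ _ := rfl

theorem inclusion_injective : Function.Injective (inclusion Γ x₀) := by
  intro α β h
  have h' : (⟨1, α⟩ : OrbifoldGroup Γ x₀) = ⟨1, β⟩ := h
  injection h' with _ h2

theorem range_inclusion : (inclusion Γ x₀).range = (eltHom Γ x₀).ker := by
  ext a
  constructor
  · rintro ⟨α, rfl⟩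
    rfl
  · intro ha
    obtain ⟨g, α⟩ := a
    obtain rfl : g = 1 := ha
    exact ⟨α, rfl⟩

end OrbifoldGroup

/-- The element `(φ, [γ])` of the orbifold fundamental group of `X/⟨φ⟩`. -/
def orbifoldGenerator (φ : X ≃ₜ X) {x₀ : X} (γ : Path (φ x₀) x₀) : QuotientGroupOf φ x₀ :=
  ⟨⟨φ, Subgroup.mem_zpowers φ⟩, Path.Homotopic.Quotient.mk γ⟩

theorem isOddCyclicExtension_inclusion (φ : X ≃ₜ X) {x₀ : X} (γ : Path (φ x₀) x₀)
    (hφ : Odd (orderOf φ)) :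
    IsOddCyclicExtension (OrbifoldGroup.inclusion (Subgroup.zpowers φ) x₀)
      (OrbifoldGroup.eltHom (Subgroup.zpowers φ) x₀) (orbifoldGenerator φ γ) where
  injective := OrbifoldGroup.inclusion_injective
  range_eq_ker := OrbifoldGroup.range_inclusion
  mem_zpowers := fun g => by
    obtain ⟨⟨_, k, rfl⟩, α⟩ := g
    refine ⟨k, Subtype.ext ?_⟩
    simp only [SubgroupClass.coe_zpow]
    rfl
  odd_orderOf := by
    rw [← Subgroup.orderOf_coe]
    change Odd (orderOf φ)
    exact hφ

/-- The representative `inducedAut φ γ` of the outer automorphism `φ_*` is conjugation by `(φ, [γ])`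
in the orbifold fundamental group. -/
theorem inclusion_inducedAut (φ : X ≃ₜ X) {x₀ : X} (γ : Path (φ x₀) x₀)
    (α : FundamentalGroup X x₀) :
    OrbifoldGroup.inclusion (Subgroup.zpowers φ) x₀ (inducedAut φ γ α) =
      orbifoldGenerator φ γ * OrbifoldGroup.inclusion (Subgroup.zpowers φ) x₀ α *
        (orbifoldGenerator φ γ)⁻¹ := by
  rw [eq_mul_inv_iff_mul_eq]
  refine OrbifoldGroup.ext_cast ((one_mul _).trans (mul_one _).symm) ?_
  have hβ : ∀ (α : Path.Homotopic.Quotient x₀ x₀),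
      (Path.Homotopic.Quotient.mk γ).trans (inducedAut φ γ α) =
        (α.map (OrbifoldGroup.toMap φ)).trans (Path.Homotopic.Quotient.mk γ) := by
    intro α
    change (Path.Homotopic.Quotient.mk γ).trans ((Path.Homotopic.Quotient.mk γ).symm.trans
      ((α.map (OrbifoldGroup.toMap φ)).trans (Path.Homotopic.Quotient.mk γ))) = _
    rw [← Path.Homotopic.Quotient.trans_assoc]
    simp
  refine Eq.trans ?_ ((hβ α).trans (Path.Homotopic.Quotient.cast_rfl_rfl _).symm)
  rfl

end OrbifoldExtension

/-! ### Connectedness of the exterior of a hyperbolic knot -/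

section Exterior

instance : PathConnectedSpace H3 := by
  have hconv : Convex ℝ {x : ℂ × ℝ | 0 < x.2} :=
    convex_halfSpace_gt (LinearMap.snd ℝ ℂ ℝ).isLinear 0
  exact isPathConnected_iff_pathConnectedSpace.mp
    (hconv.isPathConnected ⟨((0 : ℂ), (1 : ℝ)), one_pos (α := ℝ)⟩)

/-- The complement of a hyperbolic knot is a continuous image of hyperbolic space. -/
theorem IsHyperbolic.isPathConnected_compl {K : Set S3} (hK : IsHyperbolic K) :
    IsPathConnected Kᶜ := by
  obtain ⟨q, hq, -, D, -, -, hD⟩ := hK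
  have hsurj : Function.Surjective q := fun y => by
    obtain ⟨x, -, hx⟩ := hD ▸ Set.mem_univ y
    exact ⟨x, hx⟩
  have := hsurj.pathConnectedSpace hq.continuous
  exact isPathConnected_iff_pathConnectedSpace.mpr this

namespace TubularNeighbourhood

variable {K : Set S3} (V : TubularNeighbourhood K)

theorem isEmbedding : Topology.IsEmbedding V.toFun := V.smooth.isEmbedding

theorem isOpenEmbedding : Topology.IsOpenEmbedding V.toFun := ⟨V.isEmbedding, V.isOpen_range⟩

/-- The radial map of `S¹ × ℂ` that pushes the open unit disc bundle without its core to the unit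
circle bundle and is the identity elsewhere. -/
noncomputable def radialPush (x : Circle × ℂ) : Circle × ℂ :=
  (x.1, x.2 / (min 1 ‖x.2‖ : ℝ))

theorem continuousAt_radialPush {x : Circle × ℂ} (hx : x.2 ≠ 0) : ContinuousAt radialPush x := by
  unfold radialPush
  refine continuousAt_fst.prodMk (continuousAt_snd.div ?_ ?_)
  · fun_prop
  · have : 0 < min 1 ‖x.2‖ := lt_min one_pos (norm_pos_iff.mpr hx)
    exact_mod_cast this.ne'

theorem radialPush_of_one_le {x : Circle × ℂ} (hx : 1 ≤ ‖x.2‖) : radialPush x = x := by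
  simp [radialPush, min_eq_left hx]

theorem one_le_norm_radialPush {x : Circle × ℂ} (hx : x.2 ≠ 0) : 1 ≤ ‖(radialPush x).2‖ := by
  have h0 : 0 < ‖x.2‖ := norm_pos_iff.mpr hx
  have h : 0 < min 1 ‖x.2‖ := lt_min one_pos h0
  rw [radialPush, norm_div, Complex.norm_real, Real.norm_of_nonneg h.le, one_le_div h]
  exact min_le_right _ _

open Classical in
/-- The retraction of `S³ ∖ K` onto the exterior given by the radial map in the tube.  It is a
total function, but its values on `K` (where the radial map divides by zero) are irrelevant. -/
noncomputable def retraction (y : S3) : S3 :=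
  if h : ∃ x, V.toFun x = y then V.toFun (radialPush h.choose) else y

theorem retraction_apply (x : Circle × ℂ) :
    V.retraction (V.toFun x) = V.toFun (radialPush x) := by
  have h : ∃ x', V.toFun x' = V.toFun x := ⟨x, rfl⟩
  rw [retraction, dif_pos h, V.isEmbedding.injective h.choose_spec]

theorem snd_ne_zero {x : Circle × ℂ} (hx : V.toFun x ∉ K) : x.2 ≠ 0 := by
  intro h0
  have hmem : V.toFun x ∈ Set.range fun u : Circle => V.toFun (u, 0) := ⟨x.1, by rw [← h0]⟩
  exact hx (V.core.subset hmem)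

theorem toFun_mem_exterior_iff (x : Circle × ℂ) : V.toFun x ∈ V.exterior ↔ 1 ≤ ‖x.2‖ := by
  rw [exterior, Set.mem_compl_iff, V.isEmbedding.injective.mem_set_image, Set.mem_ofPred_eq, not_lt]

theorem retraction_eq_self {y : S3} (hy : y ∈ V.exterior) : V.retraction y = y := by
  by_cases h : ∃ x, V.toFun x = y
  · obtain ⟨x, rfl⟩ := h
    rw [retraction_apply, radialPush_of_one_le ((V.toFun_mem_exterior_iff x).mp hy)]
  · rw [retraction, dif_neg h]

theorem retraction_mem_exterior {y : S3} (hy : y ∉ K) : V.retraction y ∈ V.exterior := by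
  by_cases h : ∃ x, V.toFun x = y
  · obtain ⟨x, rfl⟩ := h
    rw [retraction_apply, toFun_mem_exterior_iff]
    exact one_le_norm_radialPush (V.snd_ne_zero hy)
  · rw [retraction, dif_neg h]
    rintro ⟨x, -, hx⟩
    exact h ⟨x, hx⟩

theorem continuousAt_retraction {y : S3} (hy : y ∉ K) : ContinuousAt V.retraction y := by
  by_cases h : ∃ x, V.toFun x = y
  · obtain ⟨x, rfl⟩ := h
    rw [← V.isOpenEmbedding.continuousAt_iff]
    have heq : V.retraction ∘ V.toFun = V.toFun ∘ radialPush := funext V.retraction_apply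
    rw [heq]
    exact V.isEmbedding.continuous.continuousAt.comp
      (continuousAt_radialPush (V.snd_ne_zero hy))
  · -- away from the closed tube of radius one, which is compact, the map is the identity
    have hcomp : IsCompact (V.toFun '' (Set.univ ×ˢ Metric.closedBall 0 1)) :=
      (isCompact_univ.prod (isCompact_closedBall 0 1)).image V.isEmbedding.continuous
    have hmem : (V.toFun '' (Set.univ ×ˢ Metric.closedBall 0 1))ᶜ ∈ nhds y :=
      hcomp.isClosed.isOpen_compl.mem_nhds fun ⟨x, _, hx⟩ => h ⟨x, hx⟩
    refine continuousAt_id.congr (Filter.eventuallyEq_of_mem hmem fun z hz => ?_)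
    refine (V.retraction_eq_self ?_).symm
    rintro ⟨x, hx, rfl⟩
    exact hz ⟨x, ⟨Set.mem_univ _, mem_closedBall_zero_iff.mpr (le_of_lt hx)⟩, rfl⟩

theorem disjoint_exterior {y : S3} (hy : y ∈ V.exterior) : y ∉ K := by
  rw [← V.core]
  rintro ⟨u, rfl⟩
  exact absurd ((V.toFun_mem_exterior_iff _).mp hy) (by simp)

/-- The exterior is a retract of the complement of the knot. -/
theorem isPathConnected_exterior (hK : IsHyperbolic K) : IsPathConnected V.exterior := by
  have himage : V.retraction '' Kᶜ = V.exterior := by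
    ext y
    constructor
    · rintro ⟨z, hz, rfl⟩
      exact V.retraction_mem_exterior hz
    · exact fun hy => ⟨y, V.disjoint_exterior hy, V.retraction_eq_self hy⟩
  rw [← himage]
  exact hK.isPathConnected_compl.image' fun y hy => (V.continuousAt_retraction hy).continuousWithinAt

end TubularNeighbourhood

theorem odd_orderOf_restrictToExterior {K : Set S3} (V : TubularNeighbourhood K)
    (ψ : S3 ≃ₘ⟮𝓡 3, 𝓡 3⟯ S3) (hV : ∀ x, x ∈ V.exterior ↔ ψ x ∈ V.exterior)
    (hodd : Odd (orderOf ψ.toHomeomorph)) : Odd (orderOf (restrictToExterior V ψ hV)) := by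
  refine hodd.of_dvd_nat (orderOf_dvd_of_pow_eq_one ?_)
  have hpow : ∀ (n : ℕ) (x : V.exterior),
      (((restrictToExterior V ψ hV) ^ n) x : S3) = (ψ.toHomeomorph ^ n) x := by
    intro n
    induction n with
    | zero => exact fun x => rfl
    | succ n ih =>
      intro x
      rw [pow_succ, pow_succ]
      exact ih (restrictToExterior V ψ hV x)
  ext x
  rw [hpow, pow_orderOf_eq_one]
  rfl

end Exterior

theorem mainTheorem6
    (K : Set S3) (hK : IsKnot K) (hhyp : IsHyperbolic K)
    (p : ℕ) (hp : p.Prime) (hodd : Odd p)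
    (ψ : S3 ≃ₘ⟮𝓡 3, 𝓡 3⟯ S3) (hψ : orderOf ψ.toHomeomorph = p) (hψK : ψ '' K = K)
    (V : TubularNeighbourhood K) (hV : ∀ x, x ∈ V.exterior ↔ ψ x ∈ V.exterior)
    (x₀ : V.exterior) :
    -- the sets of irreducible characters are Zariski open
    IsOpen (CharacterVariety.irreducibleCharacters
      (QuotientGroupOf (restrictToExterior V ψ hV) x₀)) ∧
    IsOpen (CharacterVariety.irreducibleCharacters (FundamentalGroup V.exterior x₀)) ∧
    -- restriction maps `X(E(K)/ψ)` to `X(K)^ψ`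
    Set.MapsTo (restriction (restrictToExterior V ψ hV) x₀)
      (CharacterVariety.mainPart (QuotientGroupOf (restrictToExterior V ψ hV) x₀))
      (invariantSubvariety (restrictToExterior V ψ hV) x₀) ∧
    -- and is a bijection between the irreducible characters of the two
    Set.BijOn (restriction (restrictToExterior V ψ hV) x₀)
      (CharacterVariety.mainPart (QuotientGroupOf (restrictToExterior V ψ hV) x₀) ∩
        CharacterVariety.irreducibleCharacters
          (QuotientGroupOf (restrictToExterior V ψ hV) x₀))
      (invariantSubvariety (restrictToExterior V ψ hV) x₀ ∩
        CharacterVariety.irreducibleCharacters (FundamentalGroup V.exterior x₀)) ∧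
    -- each irreducible representation with character in `X(K)^ψ` extends uniquely
    ∀ ρ : FundamentalGroup V.exterior x₀ →* SL2C, IsIrreducibleRep ρ →
      CharacterVariety.ofRep ρ ∈ invariantSubvariety (restrictToExterior V ψ hV) x₀ →
      ∃! ρ' : QuotientGroupOf (restrictToExterior V ψ hV) x₀ →* SL2C,
        ρ'.comp (OrbifoldGroup.inclusion
          (Subgroup.zpowers (restrictToExterior V ψ hV)) x₀) = ρ := by
  have : PathConnectedSpace V.exterior :=
    isPathConnected_iff_pathConnectedSpace.mp (V.isPathConnected_exterior hhyp)
  have hord : Odd (orderOf (restrictToExterior V ψ hV)) :=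
    odd_orderOf_restrictToExterior V ψ hV (hψ ▸ hodd)
  generalize restrictToExterior V ψ hV = φ at hord ⊢
  obtain ⟨γ⟩ : Nonempty (Path (φ x₀) x₀) := PathConnectedSpace.joined _ _
  have hext := isOddCyclicExtension_inclusion φ γ hord
  have hfixed : ∀ (χ : CharacterVariety (QuotientGroupOf φ x₀)) (δ : Path (φ x₀) x₀),
      (restriction φ x₀ χ).pullback (inducedAut φ δ) = restriction φ x₀ χ := fun χ δ =>
    CharacterVariety.pullback_eq_of_conj (inclusion_inducedAut φ δ) χ
  refine ⟨CharacterVariety.isOpen_irreducibleCharacters,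
    CharacterVariety.isOpen_irreducibleCharacters,
    hext.mapsTo_pullback_mainPart fun χ hχ => ⟨hχ, hfixed χ⟩, ?_, fun ρ hρ hinv => ?_⟩
  · rw [CharacterVariety.mainPart_inter_irreducibleCharacters, invariantSubvariety,
      CharacterVariety.nonabelianPart_inter_irreducibleCharacters]
    have hbij := hext.bijOn_pullback (inclusion_inducedAut φ γ)
    refine (congrArg (Set.BijOn (restriction φ x₀) _) (Set.ext fun χ => ?_)).mp hbij
    refine ⟨fun ⟨h, hirr⟩ =>
      ⟨⟨CharacterVariety.irreducibleCharacters_subset_mainPart hirr, ?_⟩, hirr⟩,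
      fun ⟨h, hirr⟩ => ⟨h.2 γ, hirr⟩⟩
    -- invariance for one path implies invariance for all, since the character extends
    obtain ⟨χ', -, rfl⟩ := hbij.surjOn ⟨h, hirr⟩
    exact hfixed χ'
  · have hfix := (CharacterVariety.nonabelianPart_subset _ hinv).2 γ
    exact hext.existsUnique_extension hρ (inclusion_inducedAut φ γ)
      (fun x => congrFun (congrArg CharacterVariety.toFun hfix) x)
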